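/- Let $d\ge 2$ be an integer, and let $R$ be a $[0,\infty)$-valued random variable whose distribution is absolutely continuous and for which there are $\beta,s\in(0,\infty)$ with $\lim_{h\to\infty}h^{s}\,\mathbb{P}(R>h)=\beta$. For each integer $n\ge1$ let $\mathbb{T}_n$ be the torus obtained from the cube $[-n/2,n/2]^d$ by identifying opposite faces, with toroidal distance $\mathrm{d}_{\mathbb{T}_n}$ and origin $o$. Let $X^{(n)}$ be an independently marked homogeneous Poisson point process of intensity $1$ on $\mathbb{T}_n$, and let $X$ be an independently marked homogeneous Poisson point process of intensity $1$ on $\mathbb{R}^d$; that is, given the points, their $[0,\infty)$-valued marks are independent and distributed as $R$. For $\alpha\ge0$ define the $[0,\infty]$-valued in-edge sums at the origin $$D^{(\alpha)}_{\mathrm{in},n}=\sum_{(\xi,r)\in X^{(n)},\ \mathrm{d}_{\mathbb{T}_n}(\xi,o)\le r}\mathrm{d}_{\mathbb{T}_n}(\xi,o)^{\alpha},\qquad D^{(\alpha)}_{\mathrm{in}}=\sum_{(\xi,r)\in X,\ |\xi|\le r}|\xi|^{\alpha},$$ where $|\cdot|$ is the Euclidean norm and $0^0=1$. Let $\kappa_d$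 be the volume of the unit ball in $\mathbb{R}^d$. Then: 1. For every $\alpha\ge0$, $D^{(\alpha)}_{\mathrm{in},n}$ converges in distribution (as random variables in $[0,\infty]$) to $D^{(\alpha)}_{\mathrm{in}}$ as $n\to\infty$. 2. If $s\le d$, then $\mathbb{P}\big(D^{(\alpha)}_{\mathrm{in}}=\infty\big)=1$ for every $\alpha\ge0$. 3. If $s>d$, then $\mathbb{E}R^d<\infty$ and $D^{(0)}_{\mathrm{in}}$ is a Poisson random variable with mean $\kappa_d\,\mathbb{E}R^d$. 4. If $s>d$, then for every $\alpha>0$, $$\lim_{t\to\infty}t^{(s-d)/\alpha}\,\mathbb{P}\big(D^{(\alpha)}_{\mathrm{in}}>t\big)=\frac{d\,\kappa_d\,\beta}{s-d}.$$ -/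

import Mathlib

open MeasureTheory ProbabilityTheory Filter Topology
open scoped NNReal ENNReal

noncomputable section

/-- `Φ`, a random subset of `E`, is a Poisson point process with intensity measure `μ` under `P`:
the number of points in a measurable set `A` of finite measure is Poisson distributed with mean
`μ A`, and the numbers of points in finitely many pairwise disjoint measurable sets are
independent. -/
structure IsPoissonPointProcess {Ω E : Type*} [MeasurableSpace Ω] [MeasurableSpace E]
    (P : Measure Ω) (μ : Measure E) (Φ : Ω → Set E) : Prop where
  count_law : ∀ A : Set E, MeasurableSet A → μ A ≠ ∞ →
    HasLaw (fun ω => (Φ ω ∩ A).encard)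
      ((poissonMeasure (μ A).toNNReal).map (Nat.cast : ℕ → ℕ∞)) P
  count_indep : ∀ (k : ℕ) (A : Fin k → Set E), (∀ i, MeasurableSet (A i)) →
    Pairwise (fun i j => Disjoint (A i) (A j)) →
    iIndepFun (fun (i : Fin k) (ω : Ω) => (Φ ω ∩ A i).encard) P

/-- `X`, a random subset of `E × [0, ∞)`, is independently marked with mark distribution `Q`:
there is a measurable enumeration `(ξ 0, r 0), (ξ 1, r 1), …` of its `N ≤ ∞` points, with distinct
locations `ξ i`, such that, given the number of points and their locations, the marks `r i`
(for `i < N`) are independent with distribution `Q`. The values `ξ i` and `r i` with `N ≤ i`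
play no role. -/
def IsIndependentlyMarked {Ω E : Type*} [MeasurableSpace Ω] [MeasurableSpace E]
    (P : Measure Ω) (Q : Measure ℝ≥0) (X : Ω → Set (E × ℝ≥0)) : Prop :=
  ∃ (N : Ω → ℕ∞) (ξ : ℕ → Ω → E) (r : ℕ → Ω → ℝ≥0),
    Measurable N ∧ (∀ i, Measurable (ξ i)) ∧ (∀ i, Measurable (r i)) ∧
    (∀ᵐ ω ∂P, Set.InjOn (fun i : ℕ => ξ i ω) {i | (i : ℕ∞) < N ω} ∧
      X ω = (fun i : ℕ => (ξ i ω, r i ω)) '' {i | (i : ℕ∞) < N ω}) ∧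
    ∀ (m : ℕ) (G : Set (ℕ∞ × (ℕ → E))) (B : Fin m → Set ℝ≥0),
      MeasurableSet G → (∀ i, MeasurableSet (B i)) →
      P {ω | (m : ℕ∞) ≤ N ω ∧ (N ω, fun i => ξ i ω) ∈ G ∧ ∀ i : Fin m, r i ω ∈ B i} =
        P {ω | (m : ℕ∞) ≤ N ω ∧ (N ω, fun i => ξ i ω) ∈ G} * ∏ i, Q (B i)

/-- An independently `[0, ∞)`-marked homogeneous Poisson point process with intensity `1`
(with respect to the volume on `E`) and mark distribution `Q`. -/
structure IsMarkedPoissonProcess {Ω E : Type*} [MeasurableSpace Ω] [MeasureSpace E]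
    (P : Measure Ω) (Q : Measure ℝ≥0) (X : Ω → Set (E × ℝ≥0)) : Prop where
  ground_poisson : IsPoissonPointProcess P (volume : Measure E) (fun ω => Prod.fst '' X ω)
  marks : IsIndependentlyMarked P Q X

instance factPNatCastPos (n : ℕ+) : Fact (0 < ((n : ℕ) : ℝ)) := ⟨Nat.cast_pos.mpr n.pos⟩

/-- The `d`-dimensional torus of side length `n`, with its product measure as volume
(of total mass `n ^ d`). -/
abbrev Torus (d : ℕ) (n : ℕ+) : Type := Fin d → AddCircle ((n : ℕ) : ℝ)

/-- The toroidal (flat, Euclidean) distance: the norm of `AddCircle n` is the distance to `0`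
modulo `n`. -/
def torusDist {d : ℕ} {n : ℕ+} (ξ η : Torus d n) : ℝ := √(∑ i, ‖ξ i - η i‖ ^ 2)

/-- The closed ball in the torus. -/
def torusBall {d : ℕ} {n : ℕ+} (ξ : Torus d n) (r : ℝ) : Set (Torus d n) :=
  {η | torusDist ξ η ≤ r}

/-- The in-edge sum at the origin of the torus: the sum, over the points `(ξ, r)` of the
configuration `φ`, of `|ξ| ^ α` if the origin centred closed ball of radius `r` contains `ξ`. -/
def torusInEdgeSum {d : ℕ} {n : ℕ+} (α : ℝ) (φ : Set (Torus d n × ℝ≥0)) : ℝ≥0∞ :=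
  ∑' x : φ, (torusBall (0 : Torus d n) (x.1.2 : ℝ)).indicator
    (fun ξ => ENNReal.ofReal (torusDist ξ 0 ^ α)) x.1.1

/-- The in-edge sum at the origin of Euclidean space. -/
def inEdgeSum {d : ℕ} (α : ℝ) (φ : Set (EuclideanSpace ℝ (Fin d) × ℝ≥0)) : ℝ≥0∞ :=
  ∑' x : φ, (Metric.closedBall (0 : EuclideanSpace ℝ (Fin d)) (x.1.2 : ℝ)).indicator
    (fun ξ => ENNReal.ofReal (‖ξ‖ ^ α)) x.1.1

/-- The volume of the unit ball in `ℝᵈ`. -/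
def unitBallVolume (d : ℕ) : ℝ :=
  (volume : Measure (EuclideanSpace ℝ (Fin d))).real (Metric.closedBall 0 1)

end

/-! The engine is the Laplace functional of the marked process (`IsMarkedPoissonProcess.laplace`):
`E exp(-∑ F(ξ, r)) = exp(-∫∫ (1 - exp(-F(x, t))) Q(dt) dx)` for measurable `F ≥ 0`. Averaging over
the marks given the locations replaces `F` by `x ↦ -log E exp(-F(x, R))`, and the Laplace functional
of the unmarked process applies to that function. With values in `[0, ∞]` and `exp(-∞) = 0`, no sum
has to be known finite beforehand.

Convergence: on the torus and on `ℝᵈ` the exponent integrates the same radial function, over the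
centred cube of side `n` and over the whole space respectively. Monotone convergence gives the
limit, and Laplace transforms at the naturals determine weak convergence on the compact space `[0,
∞]` by Stone-Weierstrass.

Case `s ≤ d`: far out the exponent density is at least a constant times `|x|^(-s)`, which is not
integrable at infinity. Hence `E exp(-D) = 0` and `D = ∞` almost surely.

Case `s > d`, in-degree: the number of marked points in a set of finite intensity is Poisson. For
`{|x| ≤ t}` the mean is `κ_d E R^d` by Fubini.

Case `s > d`, tail: a single long edge is responsible. The number of edges longer than `u` is
Poisson with mean `Λ(u) ~ d κ_d β / (s - d) * u^(d - s)`. One edge longer than `t^(1/α)` already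
makes the sum exceed `t`, whence the lower bound. For the upper bound, unless some term exceeds `b`,
two terms exceed `v`, or the degree exceeds `m`, the sum is at most `v m + b`. With `v = t^(3/4)`,
`m = t^(1/8)` and `b = t - v m`, the first event has the claimed asymptotics and the other two are
negligible (`tendsto_measureReal_inEdgeSum`). -/

/-! ### The decreasing exponential on `[0, ∞]` -/

/-- The function `x ↦ exp (-x)` on `[0, ∞]`, with `exp (-∞) = 0`. -/
noncomputable def expNeg (x : ℝ≥0∞) : ℝ≥0∞ := EReal.exp (-(x : EReal))

@[simp] lemma expNeg_zero : expNeg 0 = 1 := by simp [expNeg]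

@[simp] lemma expNeg_top : expNeg ∞ = 0 := by simp [expNeg]

lemma expNeg_eq_inv (x : ℝ≥0∞) : expNeg x = (EReal.exp x)⁻¹ := EReal.exp_neg _

lemma expNeg_add (x y : ℝ≥0∞) : expNeg (x + y) = expNeg x * expNeg y := by
  simp only [expNeg_eq_inv, EReal.coe_ennreal_add, EReal.exp_add]
  refine ENNReal.mul_inv (Or.inl ?_) (Or.inr ?_)
  · simp
  · simp

lemma expNeg_strictAnti : StrictAnti expNeg := fun _ _ h =>
  EReal.exp_strictMono (EReal.neg_lt_neg_iff.2 (EReal.coe_ennreal_lt_coe_ennreal_iff.2 h))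

lemma expNeg_le_one (x : ℝ≥0∞) : expNeg x ≤ 1 :=
  expNeg_zero ▸ expNeg_strictAnti.antitone zero_le

lemma expNeg_ne_top (x : ℝ≥0∞) : expNeg x ≠ ∞ :=
  ((expNeg_le_one x).trans_lt ENNReal.one_lt_top).ne

lemma continuous_expNeg : Continuous expNeg :=
  ENNReal.continuous_exp.comp (continuous_neg.comp continuous_coe_ennreal_ereal)

@[fun_prop]
lemma measurable_expNeg : Measurable expNeg := continuous_expNeg.measurable

lemma expNeg_eq_zero_iff {x : ℝ≥0∞} : expNeg x = 0 ↔ x = ∞ := by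
  rw [← expNeg_top, expNeg_strictAnti.injective.eq_iff]

lemma expNeg_ofReal {x : ℝ} (hx : 0 ≤ x) :
    expNeg (ENNReal.ofReal x) = ENNReal.ofReal (Real.exp (-x)) := by
  rw [expNeg, EReal.coe_ennreal_ofReal, max_eq_left hx, ← EReal.coe_neg, EReal.exp_coe]

lemma expNeg_sum {ι : Type*} (s : Finset ι) (f : ι → ℝ≥0∞) :
    expNeg (∑ i ∈ s, f i) = ∏ i ∈ s, expNeg (f i) := by
  classical
  induction s using Finset.induction_on with
  | empty => simp
  | insert a s ha ih => rw [Finset.sum_insert ha, Finset.prod_insert ha, expNeg_add, ih]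

lemma expNeg_natCast_mul (k : ℕ) (x : ℝ≥0∞) : expNeg (k * x) = expNeg x ^ k := by
  have := expNeg_sum (Finset.range k) (fun _ => x)
  simpa using this

lemma tendsto_expNeg_tsum (f : ℕ → ℝ≥0∞) :
    Tendsto (fun m => expNeg (∑ i ∈ Finset.range m, f i)) atTop (𝓝 (expNeg (∑' i, f i))) :=
  (continuous_expNeg.tendsto _).comp (ENNReal.tendsto_nat_tsum f)

/-- The inverse of `expNeg` on `[0, 1]`. -/
noncomputable def negLog (y : ℝ≥0∞) : ℝ≥0∞ := (-(ENNReal.log y)).toENNReal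

lemma expNeg_negLog {y : ℝ≥0∞} (hy : y ≤ 1) : expNeg (negLog y) = y := by
  have h : (0 : EReal) ≤ -(ENNReal.log y) := by
    rw [EReal.le_neg, neg_zero]
    simpa using ENNReal.log_monotone hy
  rw [expNeg, negLog, EReal.coe_toENNReal h, neg_neg, ENNReal.exp_log]

@[fun_prop]
lemma measurable_negLog : Measurable negLog :=
  measurable_ereal_toENNReal.comp ((continuous_neg (G := EReal)).measurable.comp
    ENNReal.measurable_log)

/-- Not limited to `y ≤ 1`: it serves the Laplace transform with `y = exp(-c)` and, later, the
exponential moment with `y = e`. -/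
lemma tsum_ofReal_poisson {l : ℝ} {y : ℝ} (hl : 0 ≤ l) (hy : 0 ≤ y) :
    ∑' n : ℕ, ENNReal.ofReal (Real.exp (-l) * l ^ n / (n.factorial : ℝ)) * ENNReal.ofReal (y ^ n) =
      ENNReal.ofReal (Real.exp (-(l * (1 - y)))) := by
  have h := (NormedSpace.expSeries_div_hasSum_exp (l * y)).mul_left (Real.exp (-l))
  rw [← Real.exp_eq_exp_ℝ, ← Real.exp_add] at h
  rw [show -(l * (1 - y)) = -l + l * y by ring, ← h.tsum_eq,
    ENNReal.ofReal_tsum_of_nonneg (fun n => by positivity) h.summable]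
  refine tsum_congr fun n => ?_
  rw [← ENNReal.ofReal_mul (by positivity)]
  congr 1
  rw [mul_pow]
  ring

lemma lintegral_expNeg_poissonMeasure (l : ℝ≥0) (c : ℝ≥0∞) :
    ∫⁻ n : ℕ, expNeg (c * n) ∂(poissonMeasure l) = expNeg (l * (1 - expNeg c)) := by
  obtain ⟨y, hy⟩ : ∃ y : ℝ≥0, (y : ℝ≥0∞) = expNeg c := ⟨_, ENNReal.coe_toNNReal (expNeg_ne_top c)⟩
  have hy1 : y ≤ 1 := by
    have := expNeg_le_one c
    rw [← hy] at this
    exact_mod_cast this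
  have h1 : (l : ℝ≥0∞) * (1 - expNeg c) = ENNReal.ofReal (l * (1 - y)) := by
    rw [← hy, ENNReal.ofReal_mul (by positivity), ENNReal.ofReal_sub _ (by positivity)]
    simp
  have h2 : 0 ≤ (l : ℝ) * (1 - y) := mul_nonneg l.coe_nonneg (sub_nonneg.2 (by exact_mod_cast hy1))
  rw [h1, expNeg_ofReal h2,
    ← tsum_ofReal_poisson l.coe_nonneg y.coe_nonneg, poissonMeasure, lintegral_sum_measure]
  refine tsum_congr fun n => ?_
  rw [lintegral_smul_measure, lintegral_dirac, mul_comm c, expNeg_natCast_mul, ← hy,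
    ENNReal.ofReal_pow y.coe_nonneg]
  simp

/-! ### The Laplace functional of a Poisson point process -/

/-- Monotone convergence for counting measure on the discrete σ-algebra, so `s` need be neither
measurable nor countable. -/
lemma tsum_subtype_iSup {E : Type*} (s : Set E) (f : ℕ → E → ℝ≥0∞) (hf : Monotone f) :
    ∑' x : s, ⨆ n, f n x = ⨆ n, ∑' x : s, f n x := by
  let _ : MeasurableSpace s := ⊤
  simp_rw [← lintegral_count]
  exact lintegral_iSup (fun n => measurable_from_top) fun m n h x => hf h x

/-- Expresses the sum through counts on disjoint fibres, whose joint law is known. The value `0` is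
left out because its fibre may have infinite intensity. -/
lemma tsum_subtype_simpleFunc {E : Type*} [MeasurableSpace E] (s : Set E)
    (h : SimpleFunc E ℝ≥0∞) :
    ∑' x : s, h x = ∑ c ∈ h.range.filter (· ≠ 0), c * ((s ∩ h ⁻¹' {c}).encard : ℝ≥0∞) := by
  classical
  have key : ∀ x, h x = ∑ c ∈ h.range.filter (· ≠ 0), (h ⁻¹' {c}).indicator (fun _ => c) x := by
    intro x
    by_cases h0 : h x = 0
    · rw [h0, Finset.sum_eq_zero]
      intro c hc
      refine Set.indicator_of_notMem (fun hx => (Finset.mem_filter.1 hc).2 ?_) _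
      rw [← h0]; exact hx.symm
    · rw [Finset.sum_eq_single (h x)]
      · exact (Set.indicator_of_mem (show x ∈ h ⁻¹' {h x} from rfl) _).symm
      · intro c _ hc
        exact Set.indicator_of_notMem (fun hx => hc hx.symm) _
      · intro hx
        exact absurd (Finset.mem_filter.2 ⟨h.mem_range_self x, h0⟩) hx
  calc ∑' x : s, h x
      = ∑' x : s, ∑ c ∈ h.range.filter (· ≠ 0), (h ⁻¹' {c}).indicator (fun _ => c) (x : E) :=
        tsum_congr fun x => key x
    _ = ∑ c ∈ h.range.filter (· ≠ 0), ∑' x : s, (h ⁻¹' {c}).indicator (fun _ => c) (x : E) :=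
        Summable.tsum_finsetSum fun _ _ => ENNReal.summable
    _ = _ := by
        refine Finset.sum_congr rfl fun c _ => ?_
        rw [tsum_subtype s, Set.indicator_indicator, ← tsum_subtype, ENNReal.tsum_set_const,
          mul_comm]

section

variable {Ω E : Type*} [MeasurableSpace Ω] [MeasurableSpace E] {P : Measure Ω}
  {μ : Measure E} {Φ : Ω → Set E}

lemma IsPoissonPointProcess.iIndepFun_count (hΦ : IsPoissonPointProcess P μ Φ) {ι : Type*}
    [Finite ι] (A : ι → Set E) (hA : ∀ i, MeasurableSet (A i))
    (hd : Pairwise (fun i j => Disjoint (A i) (A j))) :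
    iIndepFun (fun (i : ι) (ω : Ω) => (Φ ω ∩ A i).encard) P := by
  have e := Finite.equivFin ι
  have := (hΦ.count_indep _ (fun i => A (e.symm i)) (fun i => hA _)
    (fun i j hij => hd (e.symm.injective.ne hij))).precomp e.injective
  simpa using this

lemma IsPoissonPointProcess.lintegral_expNeg_count (hΦ : IsPoissonPointProcess P μ Φ)
    {A : Set E} (hA : MeasurableSet A) (hfin : μ A ≠ ∞) (c : ℝ≥0∞) :
    ∫⁻ ω, expNeg (c * ((Φ ω ∩ A).encard : ℝ≥0∞)) ∂P = expNeg ((1 - expNeg c) * μ A) := by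
  have hm : Measurable fun n : ℕ∞ => expNeg (c * (n : ℝ≥0∞)) := measurable_from_top
  have h := hΦ.count_law A hA hfin
  rw [← lintegral_map' (f := fun n : ℕ∞ => expNeg (c * (n : ℝ≥0∞))) hm.aemeasurable h.aemeasurable,
    h.map_eq, lintegral_map hm measurable_from_top]
  simp only [ENat.toENNReal_coe]
  rw [lintegral_expNeg_poissonMeasure, ENNReal.coe_toNNReal hfin, mul_comm]

lemma IsPoissonPointProcess.aemeasurable_tsum_simpleFunc (hΦ : IsPoissonPointProcess P μ Φ)
    (h : SimpleFunc E ℝ≥0∞) (hμ : ∀ c ≠ 0, μ (h ⁻¹' {c}) ≠ ∞) :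
    AEMeasurable (fun ω => ∑' x : Φ ω, h x) P := by
  simp_rw [tsum_subtype_simpleFunc]
  refine Finset.aemeasurable_fun_sum _ fun c hc => ?_
  have := (hΦ.count_law _ (h.measurableSet_fiber c) (hμ c (Finset.mem_filter.1 hc).2)).aemeasurable
  exact (measurable_from_top (f := fun n : ℕ∞ => c * (n : ℝ≥0∞))).comp_aemeasurable this

/-- The counts on the fibres are independent and Poisson, and the exponential turns the weighted sum
of counts into a product. -/
lemma IsPoissonPointProcess.laplace_simpleFunc (hΦ : IsPoissonPointProcess P μ Φ)
    (h : SimpleFunc E ℝ≥0∞) (hμ : ∀ c ≠ 0, μ (h ⁻¹' {c}) ≠ ∞) :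
    ∫⁻ ω, expNeg (∑' x : Φ ω, h x) ∂P = expNeg (∫⁻ x, (1 - expNeg (h x)) ∂μ) := by
  classical
  set S := h.range.filter (· ≠ 0) with hS
  have hind : iIndepFun (fun (c : S) (ω : Ω) => (Φ ω ∩ h ⁻¹' {(c : ℝ≥0∞)}).encard) P :=
    hΦ.iIndepFun_count _ (fun c => h.measurableSet_fiber _) fun c c' hc =>
      Disjoint.preimage _ (Set.disjoint_singleton.2 fun h => hc (Subtype.ext h))
  have hmeas (c : S) : AEMeasurable (fun ω => (Φ ω ∩ h ⁻¹' {(c : ℝ≥0∞)}).encard) P :=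
    (hΦ.count_law _ (h.measurableSet_fiber c) (hμ c (Finset.mem_filter.1 c.2).2)).aemeasurable
  let Y (c : S) (ω : Ω) : ℝ≥0∞ := expNeg (c * ((Φ ω ∩ h ⁻¹' {(c : ℝ≥0∞)}).encard : ℝ≥0∞))
  have hYm (c : S) : AEMeasurable (Y c) P :=
    (measurable_from_top (f := fun n : ℕ∞ => expNeg (c * (n : ℝ≥0∞)))).comp_aemeasurable (hmeas c)
  have hYind : iIndepFun Y P :=
    hind.comp (fun (c : S) (n : ℕ∞) => expNeg (c * (n : ℝ≥0∞))) fun c => measurable_from_top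
  -- The counts are only almost everywhere measurable, so the factorisation is applied to measurable
  -- versions.
  have hYind' : iIndepFun (fun c => (hYm c).mk (Y c)) P := hYind.congr fun c => (hYm c).ae_eq_mk
  have hprod : ∀ᵐ ω ∂P, ∏ c : S, Y c ω = ∏ c : S, (hYm c).mk (Y c) ω := by
    filter_upwards [ae_all_iff.2 fun c : S => (hYm c).ae_eq_mk] with ω hω
    exact Finset.prod_congr rfl fun c _ => hω c
  have h1 : ∀ ω, expNeg (∑' x : Φ ω, h x) = ∏ c : S, Y c ω := fun ω => by
    rw [tsum_subtype_simpleFunc, expNeg_sum, ← Finset.prod_coe_sort]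
  simp_rw [h1]
  rw [lintegral_congr_ae hprod, lintegral_prod_eq_prod_lintegral_of_indepFun _ _ hYind'
    fun c => (hYm c).measurable_mk]
  have h2 : ∀ c : S, ∫⁻ ω, (hYm c).mk (Y c) ω ∂P =
      expNeg ((1 - expNeg (c : ℝ≥0∞)) * μ (h ⁻¹' {(c : ℝ≥0∞)})) := fun c => by
    rw [← hΦ.lintegral_expNeg_count (h.measurableSet_fiber _)
      (hμ c (Finset.mem_filter.1 c.2).2)]
    exact lintegral_congr_ae (hYm c).ae_eq_mk.symm
  rw [Finset.prod_congr rfl fun c _ => h2 c, ← expNeg_sum]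
  congr 1
  have h3 : ∫⁻ x, (1 - expNeg (h x)) ∂μ = ∑ c ∈ h.range, (1 - expNeg c) * μ (h ⁻¹' {c}) := by
    rw [← SimpleFunc.map_lintegral (fun c => 1 - expNeg c) h, ← SimpleFunc.lintegral_eq_lintegral]
    rfl
  -- Restoring the value `0` to the sum is harmless, since `1 - exp(-0) = 0`.
  rw [h3, Finset.sum_coe_sort S (fun c => (1 - expNeg c) * μ (h ⁻¹' {c})), hS,
    Finset.sum_filter_of_ne]
  rintro c _ hc rfl
  simp at hc

/-- Simple functions with fibres of finite measure, increasing to a given function. -/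
lemma exists_monotone_simpleFunc_finite [SigmaFinite μ] {H : E → ℝ≥0∞} (hH : Measurable H) :
    ∃ h : ℕ → SimpleFunc E ℝ≥0∞, Monotone (fun n => (h n : E → ℝ≥0∞)) ∧
      (∀ n, ∀ c ≠ 0, μ (h n ⁻¹' {c}) ≠ ∞) ∧ ∀ x, ⨆ n, h n x = H x := by
  classical
  let h (n : ℕ) : SimpleFunc E ℝ≥0∞ :=
    (SimpleFunc.eapprox H n).restrict (spanningSets μ n)
  have hval (n : ℕ) (x : E) :
      h n x = (spanningSets μ n).indicator (SimpleFunc.eapprox H n) x :=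
    SimpleFunc.restrict_apply _ (measurableSet_spanningSets μ n) x
  have hmono : Monotone (fun n => (h n : E → ℝ≥0∞)) := by
    intro m n hmn x
    simp only [hval]
    exact (Set.indicator_le_indicator (SimpleFunc.monotone_eapprox H hmn x)).trans
      (Set.indicator_le_indicator_of_subset (monotone_spanningSets μ hmn) (fun _ => zero_le) x)
  refine ⟨h, hmono, fun n c hc => ?_, fun x => ?_⟩
  · refine ((measure_mono ?_).trans_lt (measure_spanningSets_lt_top μ n)).ne
    intro x hx
    by_contra hxs
    apply hc
    rw [← Set.mem_singleton_iff.1 hx, hval, Set.indicator_of_notMem hxs]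
  · rw [← SimpleFunc.iSup_eapprox_apply hH x]
    refine le_antisymm (iSup_mono fun n => ?_) (iSup_le fun n => ?_)
    · rw [hval]; exact Set.indicator_le_self _ _ _
    · obtain ⟨N, hN⟩ := Set.mem_iUnion.1 ((iUnion_spanningSets μ).symm ▸ Set.mem_univ x)
      refine le_iSup_of_le (max n N) ?_
      rw [hval, Set.indicator_of_mem (monotone_spanningSets μ (le_max_right n N) hN)]
      exact SimpleFunc.monotone_eapprox H (le_max_left n N) x

lemma tendsto_expNeg_iSup {a : ℕ → ℝ≥0∞} (ha : Monotone a) :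
    Tendsto (fun n => expNeg (a n)) atTop (𝓝 (expNeg (⨆ n, a n))) :=
  (continuous_expNeg.tendsto _).comp (tendsto_atTop_iSup ha)

lemma tendsto_lintegral_of_le_one {α : Type*} [MeasurableSpace α] {ν : Measure α}
    [IsFiniteMeasure ν] {f : ℕ → α → ℝ≥0∞} {g : α → ℝ≥0∞} (hf : ∀ n, AEMeasurable (f n) ν)
    (h1 : ∀ n x, f n x ≤ 1) (h : ∀ x, Tendsto (fun n => f n x) atTop (𝓝 (g x))) :
    Tendsto (fun n => ∫⁻ x, f n x ∂ν) atTop (𝓝 (∫⁻ x, g x ∂ν)) :=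
  tendsto_lintegral_of_dominated_convergence' (fun _ => 1) hf
    (fun n => Eventually.of_forall (h1 n)) (by simp) (Eventually.of_forall h)

lemma IsPoissonPointProcess.aemeasurable_tsum [SigmaFinite μ] (hΦ : IsPoissonPointProcess P μ Φ)
    {H : E → ℝ≥0∞} (hH : Measurable H) : AEMeasurable (fun ω => ∑' x : Φ ω, H x) P := by
  obtain ⟨h, hmono, hfin, hsup⟩ := exists_monotone_simpleFunc_finite (μ := μ) hH
  simp_rw [← hsup]
  simp_rw [tsum_subtype_iSup _ (fun n => (h n : E → ℝ≥0∞)) hmono]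
  exact AEMeasurable.iSup fun n => hΦ.aemeasurable_tsum_simpleFunc (h n) (hfin n)

/-- The Laplace functional of a Poisson point process. -/
theorem IsPoissonPointProcess.laplace [SigmaFinite μ] [IsFiniteMeasure P]
    (hΦ : IsPoissonPointProcess P μ Φ) {H : E → ℝ≥0∞} (hH : Measurable H) :
    ∫⁻ ω, expNeg (∑' x : Φ ω, H x) ∂P = expNeg (∫⁻ x, (1 - expNeg (H x)) ∂μ) := by
  obtain ⟨h, hmono, hfin, hsup⟩ := exists_monotone_simpleFunc_finite (μ := μ) hH
  have hl : Tendsto (fun n => ∫⁻ ω, expNeg (∑' x : Φ ω, h n x) ∂P) atTop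
      (𝓝 (∫⁻ ω, expNeg (∑' x : Φ ω, H x) ∂P)) := by
    refine tendsto_lintegral_of_le_one (fun n => measurable_expNeg.comp_aemeasurable
      (hΦ.aemeasurable_tsum_simpleFunc (h n) (hfin n))) (fun n ω => expNeg_le_one _) fun ω => ?_
    simp_rw [← hsup]
    rw [tsum_subtype_iSup _ (fun n => (h n : E → ℝ≥0∞)) hmono]
    exact tendsto_expNeg_iSup fun m n hmn => ENNReal.tsum_le_tsum fun x => hmono hmn x
  have hr : Tendsto (fun n => expNeg (∫⁻ x, (1 - expNeg (h n x)) ∂μ)) atTop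
      (𝓝 (expNeg (∫⁻ x, (1 - expNeg (H x)) ∂μ))) := by
    refine (continuous_expNeg.tendsto _).comp (lintegral_tendsto_of_tendsto_of_monotone
      (fun n => by fun_prop) (Eventually.of_forall fun x m n hmn => ?_)
      (Eventually.of_forall fun x => ?_))
    · exact tsub_le_tsub_left (expNeg_strictAnti.antitone (hmono hmn x)) 1
    · rw [← hsup]
      exact ENNReal.Tendsto.sub tendsto_const_nhds
        (tendsto_expNeg_iSup fun m n hmn => hmono hmn x) (Or.inl ENNReal.one_ne_top)
  refine tendsto_nhds_unique hl ?_
  simpa only [hΦ.laplace_simpleFunc _ (hfin _)] using hr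

end

/-! ### The Laplace functional of an independently marked Poisson point process -/

/-- Splits by the number `k = min n m` of factors actually present. For each `k` only the first `k`
marks occur, and their conditional law is available. -/
lemma prod_range_ite_lt (n : ℕ∞) (m : ℕ) (a : ℕ → ℝ≥0∞) :
    ∏ i ∈ Finset.range m, (if (i : ℕ∞) < n then a i else 1) =
      ∑ k ∈ Finset.range (m + 1), (if min n m = k then ∏ i : Fin k, a i else 0) := by
  obtain ⟨l, hl⟩ : ∃ l : ℕ, min n (m : ℕ∞) = l := by
    refine ⟨(min n (m : ℕ∞)).toNat, (ENat.natCast_toNat ?_).symm⟩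
    exact ((min_le_right n (m : ℕ∞)).trans_lt (ENat.natCast_lt_top m)).ne
  have hlm : l ≤ m := by
    have := min_le_right n (m : ℕ∞)
    rw [hl] at this
    exact_mod_cast this
  rw [Finset.sum_eq_single l (fun k _ hk => if_neg fun h => hk (by exact_mod_cast h.symm.trans hl))
    (fun h => absurd (Finset.mem_range.2 (Nat.lt_succ_of_le hlm)) h), if_pos hl,
    ← Finset.prod_filter, Fin.prod_univ_eq_prod_range a l]
  refine Finset.prod_congr ?_ fun _ _ => rfl
  ext i
  have : (i : ℕ∞) < min n m ↔ i < l := by rw [hl]; exact_mod_cast Iff.rfl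
  rw [Finset.mem_filter, Finset.mem_range, Finset.mem_range, ← this, lt_min_iff, and_comm]
  exact and_congr_right fun _ => by exact_mod_cast Iff.rfl

lemma lintegral_pi_prod {α : Type*} [MeasurableSpace α] (Q : Measure α) [IsProbabilityMeasure Q]
    {k : ℕ} (f : Fin k → α → ℝ≥0∞) (hf : ∀ i, Measurable (f i)) :
    ∫⁻ t : Fin k → α, ∏ i, f i (t i) ∂(Measure.pi fun _ => Q) = ∏ i, ∫⁻ t, f i t ∂Q := by
  rw [lintegral_prod_eq_prod_lintegral_of_indepFun Finset.univ
    (fun i (t : Fin k → α) => f i (t i)) (iIndepFun_pi fun i => (hf i).aemeasurable)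
    fun i => (hf i).comp (measurable_pi_apply i)]
  refine Finset.prod_congr rfl fun i _ => ?_
  exact (measurePreserving_eval (fun _ : Fin k => Q) i).lintegral_comp (hf i)

section

variable {Ω E : Type*} [MeasurableSpace Ω] [MeasurableSpace E] {P : Measure Ω}
  [IsProbabilityMeasure P] {Q : Measure ℝ≥0} [IsProbabilityMeasure Q]
  {N : Ω → ℕ∞} {ξ : ℕ → Ω → E} {r : ℕ → Ω → ℝ≥0}

/-- The hypothesis is the product formula on a π-system of rectangles, which determines the joint
law. The restriction to `k ≤ N` is needed because marks with index at least `N` are arbitrary. -/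
lemma map_restrict_marks (hN : Measurable N) (hξ : ∀ i, Measurable (ξ i))
    (hr : ∀ i, Measurable (r i))
    (hlaw : ∀ (m : ℕ) (G : Set (ℕ∞ × (ℕ → E))) (B : Fin m → Set ℝ≥0),
      MeasurableSet G → (∀ i, MeasurableSet (B i)) →
      P {ω | (m : ℕ∞) ≤ N ω ∧ (N ω, fun i => ξ i ω) ∈ G ∧ ∀ i : Fin m, r i ω ∈ B i} =
        P {ω | (m : ℕ∞) ≤ N ω ∧ (N ω, fun i => ξ i ω) ∈ G} * ∏ i, Q (B i)) (k : ℕ) :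
    (P.restrict {ω | (k : ℕ∞) ≤ N ω}).map
        (fun ω => ((N ω, fun i => ξ i ω), fun i : Fin k => r i ω)) =
      ((P.restrict {ω | (k : ℕ∞) ≤ N ω}).map (fun ω => (N ω, fun i => ξ i ω))).prod
        (Measure.pi fun _ => Q) := by
  have hT : Measurable (fun ω => (N ω, fun i => ξ i ω)) := hN.prodMk (measurable_pi_lambda _ hξ)
  have hR : Measurable (fun ω => fun i : Fin k => r i ω) := measurable_pi_lambda _ fun i => hr i
  have hfin : IsFiniteMeasure
      ((P.restrict {ω | (k : ℕ∞) ≤ N ω}).map (fun ω => (N ω, fun i => ξ i ω))) := inferInstance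
  symm
  refine Measure.prod_eq_generateFrom (C := {s | MeasurableSet s})
    (D := Set.pi Set.univ '' Set.pi Set.univ fun _ : Fin k => {s : Set ℝ≥0 | MeasurableSet s})
    MeasurableSpace.generateFrom_measurableSet generateFrom_pi
    MeasurableSpace.isPiSystem_measurableSet isPiSystem_pi
    (Measure.toFiniteSpanningSetsIn _)
    ⟨fun _ => Set.univ, fun _ => ⟨fun _ => Set.univ,
      fun _ _ => (MeasurableSet.univ : MeasurableSet (Set.univ : Set ℝ≥0)),
      Set.pi_univ _⟩, fun _ => by simp, Set.iUnion_const _⟩ ?_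
  rintro G hG _ ⟨B, hB, rfl⟩
  have hB' : ∀ i, MeasurableSet (B i) := fun i => hB i (Set.mem_univ i)
  have hG' : MeasurableSet G := hG
  rw [Measure.map_apply (hT.prodMk hR) (hG'.prod (MeasurableSet.univ_pi hB')),
    Measure.map_apply hT hG', Measure.restrict_apply (hT hG'),
    Measure.restrict_apply ((hT.prodMk hR) (hG'.prod (MeasurableSet.univ_pi hB'))), Measure.pi_pi]
  convert! hlaw k G B hG' hB' using 2
  · ext ω
    simp only [Set.mem_inter_iff, Set.mem_preimage, Set.mem_prod, Set.mem_pi, Set.mem_univ,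
      true_imp_iff, Set.mem_ofPred_eq]
    tauto
  · congr 1
    ext ω
    simp only [Set.mem_inter_iff, Set.mem_preimage, Set.mem_ofPred_eq]
    tauto

lemma lintegral_partial_marks (hN : Measurable N) (hξ : ∀ i, Measurable (ξ i))
    (hr : ∀ i, Measurable (r i))
    (hlaw : ∀ (m : ℕ) (G : Set (ℕ∞ × (ℕ → E))) (B : Fin m → Set ℝ≥0),
      MeasurableSet G → (∀ i, MeasurableSet (B i)) →
      P {ω | (m : ℕ∞) ≤ N ω ∧ (N ω, fun i => ξ i ω) ∈ G ∧ ∀ i : Fin m, r i ω ∈ B i} =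
        P {ω | (m : ℕ∞) ≤ N ω ∧ (N ω, fun i => ξ i ω) ∈ G} * ∏ i, Q (B i))
    {φ : E × ℝ≥0 → ℝ≥0∞} (hφ : Measurable φ) (m : ℕ) :
    ∫⁻ ω, ∏ i ∈ Finset.range m, (if (i : ℕ∞) < N ω then φ (ξ i ω, r i ω) else 1) ∂P =
      ∫⁻ ω, ∏ i ∈ Finset.range m,
        (if (i : ℕ∞) < N ω then ∫⁻ t, φ (ξ i ω, t) ∂Q else 1) ∂P := by
  classical
  have hT : Measurable (fun ω => (N ω, fun i => ξ i ω)) := hN.prodMk (measurable_pi_lambda _ hξ)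
  have hR (k : ℕ) : Measurable (fun ω => fun i : Fin k => r i ω) :=
    measurable_pi_lambda _ fun i => hr i
  have hg : Measurable fun x => ∫⁻ t, φ (x, t) ∂Q := hφ.lintegral_prod_right'
  have hmin (k : ℕ) : MeasurableSet {ω | min (N ω) (m : ℕ∞) = k} :=
    hN (MeasurableSpace.measurableSet_top (s := {n | min n (m : ℕ∞) = k}))
  rw [lintegral_congr fun ω => prod_range_ite_lt (N ω) m fun i => φ (ξ i ω, r i ω),
    lintegral_congr fun ω => prod_range_ite_lt (N ω) m fun i => ∫⁻ t, φ (ξ i ω, t) ∂Q,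
    lintegral_finsetSum _ fun k _ => ?_, lintegral_finsetSum _ fun k _ => ?_]
  · refine Finset.sum_congr rfl fun k _ => ?_
    let D : Set (ℕ∞ × (ℕ → E)) := {p | min p.1 (m : ℕ∞) = k}
    have hD : MeasurableSet D :=
      measurable_fst (MeasurableSpace.measurableSet_top (s := {n | min n (m : ℕ∞) = k}))
    have hk : MeasurableSet {ω | (k : ℕ∞) ≤ N ω} :=
      hN (MeasurableSpace.measurableSet_top (s := {n | (k : ℕ∞) ≤ n}))
    -- `min N m = k` forces `k ≤ N`, so restricting to the latter event loses nothing.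
    have hrestr (f : Ω → ℝ≥0∞) : ∫⁻ ω, (if min (N ω) (m : ℕ∞) = k then f ω else 0) ∂P =
        ∫⁻ ω in {ω | (k : ℕ∞) ≤ N ω}, (if min (N ω) (m : ℕ∞) = k then f ω else 0) ∂P := by
      rw [← lintegral_indicator hk]
      refine lintegral_congr fun ω => ?_
      by_cases h : min (N ω) (m : ℕ∞) = k
      · rw [Set.indicator_of_mem]
        exact h.symm.trans_le (min_le_left (N ω) _)
      · simp only [Set.indicator_apply, if_neg h, ite_self]
    rw [hrestr, hrestr]
    let f : (ℕ∞ × (ℕ → E)) × (Fin k → ℝ≥0) → ℝ≥0∞ := fun q =>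
      if q.1 ∈ D then ∏ i : Fin k, φ (q.1.2 i, q.2 i) else 0
    have hf : Measurable f := by
      refine Measurable.ite (measurable_fst hD) ?_ measurable_const
      refine Finset.measurable_fun_prod _ fun i _ => hφ.comp ?_
      exact ((measurable_pi_apply (i : ℕ)).comp (measurable_snd.comp measurable_fst)).prodMk
        ((measurable_pi_apply i).comp measurable_snd)
    have h1 := lintegral_map (μ := P.restrict {ω | (k : ℕ∞) ≤ N ω}) hf (hT.prodMk (hR k))
    rw [map_restrict_marks hN hξ hr hlaw k, lintegral_prod _ hf.aemeasurable,
      lintegral_map hf.lintegral_prod_right' hT] at h1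
    refine h1.symm.trans (lintegral_congr fun ω => ?_)
    by_cases h : min (N ω) (m : ℕ∞) = k
    · have h' : (N ω, fun i => ξ i ω) ∈ D := h
      simp only [f, if_pos h, if_pos h']
      exact lintegral_pi_prod Q (fun i t => φ (ξ i ω, t)) fun i => hφ.comp measurable_prodMk_left
    · have h' : (N ω, fun i => ξ i ω) ∉ D := h
      simp only [f, if_neg h, if_neg h', lintegral_zero]
  · exact Measurable.ite (hmin k) (Finset.measurable_fun_prod _ fun i _ => hg.comp (hξ i))
      measurable_const
  · exact Measurable.ite (hmin k) (Finset.measurable_fun_prod _ fun i _ =>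
      hφ.comp ((hξ i).prodMk (hr i))) measurable_const

lemma tsum_image_enumeration {α : Type*} {n : ℕ∞} {a : ℕ → α}
    (ha : Set.InjOn a {i | (i : ℕ∞) < n}) (F : α → ℝ≥0∞) :
    ∑' p : (a '' {i : ℕ | (i : ℕ∞) < n} : Set α), F p =
      ∑' i : ℕ, if (i : ℕ∞) < n then F (a i) else 0 := by
  rw [tsum_image F ha, tsum_subtype {i : ℕ | (i : ℕ∞) < n} (fun i => F (a i))]
  refine tsum_congr fun i => ?_
  simp [Set.indicator_apply]

/-- Limit `m → ∞` of `lintegral_partial_marks`, dominated by `1`. Writing the averaged factor as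
`expNeg` of its `negLog` makes both partial products exponentials of partial sums. -/
lemma lintegral_expNeg_marks (hN : Measurable N) (hξ : ∀ i, Measurable (ξ i))
    (hr : ∀ i, Measurable (r i))
    (hlaw : ∀ (m : ℕ) (G : Set (ℕ∞ × (ℕ → E))) (B : Fin m → Set ℝ≥0),
      MeasurableSet G → (∀ i, MeasurableSet (B i)) →
      P {ω | (m : ℕ∞) ≤ N ω ∧ (N ω, fun i => ξ i ω) ∈ G ∧ ∀ i : Fin m, r i ω ∈ B i} =
        P {ω | (m : ℕ∞) ≤ N ω ∧ (N ω, fun i => ξ i ω) ∈ G} * ∏ i, Q (B i))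
    {F : E × ℝ≥0 → ℝ≥0∞} (hF : Measurable F) :
    ∫⁻ ω, expNeg (∑' i : ℕ, if (i : ℕ∞) < N ω then F (ξ i ω, r i ω) else 0) ∂P =
      ∫⁻ ω, expNeg (∑' i : ℕ, if (i : ℕ∞) < N ω then
        negLog (∫⁻ t, expNeg (F (ξ i ω, t)) ∂Q) else 0) ∂P := by
  have hlt (i : ℕ) : MeasurableSet {ω | (i : ℕ∞) < N ω} :=
    hN (MeasurableSpace.measurableSet_top (s := {n | (i : ℕ∞) < n}))
  have hg : Measurable fun x => ∫⁻ t, expNeg (F (x, t)) ∂Q :=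
    (measurable_expNeg.comp hF).lintegral_prod_right'
  have hle (x : E) : ∫⁻ t, expNeg (F (x, t)) ∂Q ≤ 1 :=
    (lintegral_mono fun t => expNeg_le_one _).trans (by simp)
  have hpart (a : ℕ → Ω → ℝ≥0∞) (ha : ∀ i, Measurable (a i)) :
      Tendsto (fun m => ∫⁻ ω, ∏ i ∈ Finset.range m,
        (if (i : ℕ∞) < N ω then expNeg (a i ω) else 1) ∂P) atTop
        (𝓝 (∫⁻ ω, expNeg (∑' i : ℕ, if (i : ℕ∞) < N ω then a i ω else 0) ∂P)) := by
    have : ∀ ω m, ∏ i ∈ Finset.range m, (if (i : ℕ∞) < N ω then expNeg (a i ω) else 1) =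
        expNeg (∑ i ∈ Finset.range m, if (i : ℕ∞) < N ω then a i ω else 0) := fun ω m => by
      rw [expNeg_sum]
      exact Finset.prod_congr rfl fun i _ => by split_ifs <;> simp
    simp only [this]
    refine tendsto_lintegral_of_le_one (fun m => ?_) (fun _ _ => expNeg_le_one _)
      fun ω => tendsto_expNeg_tsum _
    refine (measurable_expNeg.comp (Finset.measurable_fun_sum _ fun i _ => ?_)).aemeasurable
    exact Measurable.ite (hlt i) (ha i) measurable_const
  refine tendsto_nhds_unique (hpart _ fun i => hF.comp ((hξ i).prodMk (hr i))) ?_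
  have h2 := hpart (fun i ω => negLog (∫⁻ t, expNeg (F (ξ i ω, t)) ∂Q))
    fun i => measurable_negLog.comp (hg.comp (hξ i))
  simp only [expNeg_negLog (hle _)] at h2
  exact h2.congr fun m =>
    (lintegral_partial_marks hN hξ hr hlaw (measurable_expNeg.comp hF) m).symm

end

section

variable {Ω E : Type*} [MeasurableSpace Ω] [MeasureSpace E] {P : Measure Ω}
  {Q : Measure ℝ≥0} {X : Ω → Set (E × ℝ≥0)}

lemma IsMarkedPoissonProcess.aemeasurable_tsum (hX : IsMarkedPoissonProcess P Q X)
    {F : E × ℝ≥0 → ℝ≥0∞} (hF : Measurable F) : AEMeasurable (fun ω => ∑' p : X ω, F p) P := by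
  obtain ⟨N, ξ, r, hN, hξ, hr, hX', -⟩ := hX.marks
  refine ⟨fun ω => ∑' i : ℕ, if (i : ℕ∞) < N ω then F (ξ i ω, r i ω) else 0, ?_, ?_⟩
  · refine Measurable.tsum fun i => Measurable.ite ?_
      (hF.comp ((hξ i).prodMk (hr i))) measurable_const
    exact hN (MeasurableSpace.measurableSet_top (s := {n | (i : ℕ∞) < n}))
  · filter_upwards [hX'] with ω hω
    rw [hω.2, tsum_image_enumeration fun i hi j hj hij => hω.1 hi hj (congrArg Prod.fst hij)]

/-- The Laplace functional of an independently marked Poisson point process. -/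
theorem IsMarkedPoissonProcess.laplace [SigmaFinite (volume : Measure E)]
    [IsProbabilityMeasure P] [IsProbabilityMeasure Q] (hX : IsMarkedPoissonProcess P Q X)
    {F : E × ℝ≥0 → ℝ≥0∞} (hF : Measurable F) :
    ∫⁻ ω, expNeg (∑' p : X ω, F p) ∂P =
      expNeg (∫⁻ x, ∫⁻ t, (1 - expNeg (F (x, t))) ∂Q) := by
  obtain ⟨N, ξ, r, hN, hξ, hr, hX', hlaw⟩ := hX.marks
  have hg : Measurable fun x => ∫⁻ t, expNeg (F (x, t)) ∂Q :=
    (measurable_expNeg.comp hF).lintegral_prod_right'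
  have hle (x : E) : ∫⁻ t, expNeg (F (x, t)) ∂Q ≤ 1 :=
    (lintegral_mono fun t => expNeg_le_one _).trans (by simp)
  have hL : ∫⁻ ω, expNeg (∑' p : X ω, F p) ∂P =
      ∫⁻ ω, expNeg (∑' i : ℕ, if (i : ℕ∞) < N ω then F (ξ i ω, r i ω) else 0) ∂P := by
    refine lintegral_congr_ae ?_
    filter_upwards [hX'] with ω hω
    rw [hω.2, tsum_image_enumeration fun i hi j hj hij => hω.1 hi hj (congrArg Prod.fst hij)]
  -- The locations are distinct, so the same enumeration lists the ground process without
  -- repetition.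
  have hR : ∫⁻ ω, expNeg (∑' x : (Prod.fst '' X ω : Set E),
        negLog (∫⁻ t, expNeg (F (x, t)) ∂Q)) ∂P =
      ∫⁻ ω, expNeg (∑' i : ℕ, if (i : ℕ∞) < N ω then
        negLog (∫⁻ t, expNeg (F (ξ i ω, t)) ∂Q) else 0) ∂P := by
    refine lintegral_congr_ae ?_
    filter_upwards [hX'] with ω hω
    rw [hω.2, Set.image_image,
      tsum_image_enumeration hω.1 (fun x => negLog (∫⁻ t, expNeg (F (x, t)) ∂Q))]
  rw [hL, lintegral_expNeg_marks hN hξ hr hlaw hF, ← hR,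
    hX.ground_poisson.laplace (H := fun x => negLog (∫⁻ t, expNeg (F (x, t)) ∂Q))
      (measurable_negLog.comp hg)]
  congr 1
  refine lintegral_congr fun x => ?_
  -- `1 - ∫ exp(-F) dQ = ∫ (1 - exp(-F)) dQ` because `Q` has mass one.
  rw [expNeg_negLog (hle x), lintegral_sub (by fun_prop)
    ((hle x).trans_lt ENNReal.one_lt_top).ne (Eventually.of_forall fun t => expNeg_le_one _)]
  simp

end

/-! ### Laplace transforms and weak convergence on `[0, ∞]` -/

/-- The function `x ↦ exp (-x)` on `[0, ∞]` as a real valued bounded continuous function. -/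
noncomputable def expNegBCF : BoundedContinuousFunction ℝ≥0∞ ℝ :=
  BoundedContinuousFunction.mkOfCompact
    ⟨fun x => (expNeg x).toReal, continuous_iff_continuousAt.2 fun x =>
      (ENNReal.tendsto_toReal (expNeg_ne_top x)).comp (continuous_expNeg.tendsto x)⟩

lemma integral_expNegBCF_pow (μ : Measure ℝ≥0∞) (k : ℕ) :
    ∫ x, (expNegBCF ^ k) x ∂μ = (∫⁻ x, expNeg (k * x) ∂μ).toReal := by
  rw [← integral_toReal (by fun_prop)
    (Eventually.of_forall fun x => (expNeg_ne_top _).lt_top)]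
  refine integral_congr_ae (Eventually.of_forall fun x => ?_)
  simp only [expNeg_natCast_mul, ENNReal.toReal_pow]
  rfl

/-- The algebra of polynomials in `exp (-x)`. -/
noncomputable def expNegAlgebra : StarSubalgebra ℝ (BoundedContinuousFunction ℝ≥0∞ ℝ) where
  toSubalgebra := Algebra.adjoin ℝ {expNegBCF}
  star_mem' := fun {a} ha => by
    have : star a = a := by ext x; simp
    rwa [this]

lemma expNegAlgebra_separatesPoints :
    (expNegAlgebra.map (BoundedContinuousFunction.toContinuousMapStarₐ ℝ)).SeparatesPoints := by
  intro x y hxy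
  refine ⟨fun x => expNegBCF x, ⟨BoundedContinuousFunction.toContinuousMapStarₐ ℝ expNegBCF,
    ⟨expNegBCF, Algebra.subset_adjoin rfl, rfl⟩, rfl⟩, fun h => hxy ?_⟩
  exact expNeg_strictAnti.injective
    ((ENNReal.toReal_eq_toReal_iff' (expNeg_ne_top x) (expNeg_ne_top y)).1 h)

/-- Probability measures on `[0, ∞]` converge weakly if their Laplace transforms converge at the
natural numbers. -/
theorem tendsto_probabilityMeasure_of_tendsto_expNeg {ι : Type*} {l : Filter ι}
    {μ : ι → ProbabilityMeasure ℝ≥0∞} {μ₀ : ProbabilityMeasure ℝ≥0∞}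
    (h : ∀ k : ℕ, Tendsto (fun i => ∫⁻ x, expNeg (k * x) ∂(μ i : Measure ℝ≥0∞)) l
      (𝓝 (∫⁻ x, expNeg (k * x) ∂(μ₀ : Measure ℝ≥0∞)))) :
    Tendsto μ l (𝓝 μ₀) := by
  -- Tightness is automatic on the compact space `[0, ∞]`. It remains to test polynomials in
  -- `exp(-x)`, and the monomials give the Laplace transform at the naturals.
  refine ProbabilityMeasure.tendsto_of_tight_of_separatesPoints ℝ .of_compactSpace
    expNegAlgebra_separatesPoints fun g hg => ?_
  have hg' : g ∈ Algebra.adjoin ℝ {expNegBCF} := hg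
  rw [Algebra.adjoin_singleton_eq_range_aeval] at hg'
  obtain ⟨p, rfl⟩ := hg'
  clear hg
  have hint (ν : ProbabilityMeasure ℝ≥0∞) (f : BoundedContinuousFunction ℝ≥0∞ ℝ) :
      Integrable f (ν : Measure ℝ≥0∞) := f.integrable _
  induction p using Polynomial.induction_on' with
  | add p q hp hq =>
    simp only [map_add, BoundedContinuousFunction.coe_add, Pi.add_apply]
    simp_rw [integral_add (hint _ _) (hint _ _)]
    exact hp.add hq
  | monomial k a =>
    have hm : ∀ x, (Polynomial.aeval expNegBCF (Polynomial.monomial k a)) x =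
        a * (expNegBCF ^ k) x := fun x => by
      rw [Polynomial.aeval_monomial, ← Algebra.smul_def]
      rfl
    have hm' (ν : ProbabilityMeasure ℝ≥0∞) :
        ∫ x, (Polynomial.aeval expNegBCF (Polynomial.monomial k a)) x ∂(ν : Measure ℝ≥0∞) =
          a * (∫⁻ x, expNeg (k * x) ∂(ν : Measure ℝ≥0∞)).toReal := by
      rw [← integral_expNegBCF_pow, ← integral_const_mul]
      exact integral_congr_ae (Eventually.of_forall hm)
    have hlim : Tendsto (fun i => a * (∫⁻ x, expNeg (k * x) ∂(μ i : Measure ℝ≥0∞)).toReal) l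
        (𝓝 (a * (∫⁻ x, expNeg (k * x) ∂(μ₀ : Measure ℝ≥0∞)).toReal)) := by
      refine Tendsto.const_mul a ((ENNReal.tendsto_toReal ?_).comp (h k))
      refine ((lintegral_mono fun x => expNeg_le_one _).trans_lt ?_).ne
      simp
    rw [← hm' μ₀] at hlim
    exact hlim.congr fun i => (hm' (μ i)).symm

theorem tendstoInDistribution_of_tendsto_expNeg {ι : Type*} {l : Filter ι}
    {Ω : ι → Type*} [∀ i, MeasurableSpace (Ω i)] {P : ∀ i, Measure (Ω i)}
    [∀ i, IsProbabilityMeasure (P i)] {Ω' : Type*} [MeasurableSpace Ω'] {P' : Measure Ω'}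
    [IsProbabilityMeasure P'] {Y : ∀ i, Ω i → ℝ≥0∞} {Z : Ω' → ℝ≥0∞}
    (hY : ∀ i, AEMeasurable (Y i) (P i)) (hZ : AEMeasurable Z P')
    (h : ∀ k : ℕ, Tendsto (fun i => ∫⁻ ω, expNeg (k * Y i ω) ∂(P i)) l
      (𝓝 (∫⁻ ω, expNeg (k * Z ω) ∂P'))) :
    TendstoInDistribution Y l Z P P' where
  forall_aemeasurable := hY
  aemeasurable_limit := hZ
  tendsto := by
    refine tendsto_probabilityMeasure_of_tendsto_expNeg fun k => ?_
    have hk : AEMeasurable (fun x : ℝ≥0∞ => expNeg (k * x)) (P'.map Z) := by fun_prop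
    have hk' (i : ι) : AEMeasurable (fun x : ℝ≥0∞ => expNeg (k * x)) ((P i).map (Y i)) := by
      fun_prop
    have := h k
    rw [← lintegral_map' hk hZ] at this
    refine this.congr fun i => ?_
    rw [← lintegral_map' (hk' i) (hY i)]
    rfl

/-- A probability measure on `[0, ∞]` is determined by its Laplace transform at the natural
numbers. -/
theorem measure_ext_of_expNeg {μ ν : Measure ℝ≥0∞} [IsProbabilityMeasure μ]
    [IsProbabilityMeasure ν] (h : ∀ k : ℕ, ∫⁻ x, expNeg (k * x) ∂μ = ∫⁻ x, expNeg (k * x) ∂ν) :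
    μ = ν := by
  let μ' : ProbabilityMeasure ℝ≥0∞ := ⟨μ, inferInstance⟩
  let ν' : ProbabilityMeasure ℝ≥0∞ := ⟨ν, inferInstance⟩
  have h1 : Tendsto (fun _ : ℕ => μ') atTop (𝓝 ν') :=
    tendsto_probabilityMeasure_of_tendsto_expNeg fun k => by
      rw [show ∫⁻ x, expNeg (k * x) ∂(ν' : Measure ℝ≥0∞) =
        ∫⁻ x, expNeg (k * x) ∂(μ' : Measure ℝ≥0∞) from (h k).symm]
      exact tendsto_const_nhds
  have h2 : μ' = ν' := tendsto_nhds_unique tendsto_const_nhds h1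
  exact congrArg Subtype.val h2

/-! ### Counts of marked points -/

section

variable {Ω E : Type*} [MeasurableSpace Ω] [MeasureSpace E] [SigmaFinite (volume : Measure E)]
  {P : Measure Ω} [IsProbabilityMeasure P] {Q : Measure ℝ≥0} [IsProbabilityMeasure Q]
  {X : Ω → Set (E × ℝ≥0)}

/-- The number of marked points in a set of finite intensity is Poisson distributed. -/
theorem IsMarkedPoissonProcess.hasLaw_count (hX : IsMarkedPoissonProcess P Q X)
    {B : Set (E × ℝ≥0)} (hB : MeasurableSet B)
    (hfin : ∫⁻ x, Q {t | (x, t) ∈ B} ≠ ∞) :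
    HasLaw (fun ω => ∑' p : X ω, B.indicator (fun _ => (1 : ℝ≥0∞)) p)
      ((poissonMeasure (∫⁻ x, Q {t | (x, t) ∈ B}).toNNReal).map (Nat.cast : ℕ → ℝ≥0∞)) P := by
  have hm : Measurable (B.indicator (fun _ => (1 : ℝ≥0∞))) := measurable_const.indicator hB
  have hS := hX.aemeasurable_tsum hm
  refine ⟨hS, ?_⟩
  have := Measure.isProbabilityMeasure_map (μ := P) hS
  refine measure_ext_of_expNeg fun k => ?_
  rw [lintegral_map' (by fun_prop) hS, lintegral_map (by fun_prop) measurable_from_top,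
    lintegral_expNeg_poissonMeasure, ENNReal.coe_toNNReal hfin]
  simp_rw [← ENNReal.tsum_mul_left]
  rw [hX.laplace (F := fun p => k * B.indicator (fun _ => (1 : ℝ≥0∞)) p) (by fun_prop)]
  congr 1
  have hQ : Measurable fun x => Q {t | (x, t) ∈ B} := measurable_measure_prodMk_left hB
  rw [mul_comm, ← lintegral_const_mul _ hQ]
  refine lintegral_congr fun x => ?_
  have hBx : MeasurableSet {t | (x, t) ∈ B} := measurable_prodMk_left hB
  rw [← lintegral_indicator_const hBx]
  refine lintegral_congr fun t => ?_
  by_cases h : (x, t) ∈ B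
  · rw [Set.indicator_of_mem h, Set.indicator_of_mem (show t ∈ {t | (x, t) ∈ B} from h), mul_one]
  · rw [Set.indicator_of_notMem h, Set.indicator_of_notMem (show t ∉ {t | (x, t) ∈ B} from h)]
    simp

end

/-! ### Radial integrals over the torus -/

/-- The half-open cube of side length `n` centred at the origin. -/
def centredCube (d n : ℕ) : Set (EuclideanSpace ℝ (Fin d)) :=
  {x | ∀ i, x i ∈ Set.Ioc (-((n : ℝ) / 2)) (-((n : ℝ) / 2) + n)}

lemma measurableSet_centredCube (d n : ℕ) : MeasurableSet (centredCube d n) := by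
  simp only [centredCube, Set.ofPred_forall]
  exact MeasurableSet.iInter fun i =>
    (measurableSet_Ioc.preimage (by fun_prop : Measurable fun x : EuclideanSpace ℝ (Fin d) => x i))

lemma centredCube_mono (d : ℕ) : Monotone (centredCube d) := by
  intro m n hmn x hx i
  have h : (m : ℝ) ≤ n := Nat.cast_le.2 hmn
  have := hx i
  constructor <;> linarith [this.1, this.2]

lemma iUnion_centredCube (d : ℕ) : ⋃ n, centredCube d n = Set.univ := by
  refine Set.eq_univ_of_forall fun x => Set.mem_iUnion.2 ?_
  obtain ⟨n, hn⟩ := exists_nat_gt (2 * ‖x‖)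
  refine ⟨n, fun i => ?_⟩
  have h : |x i| ≤ ‖x‖ := PiLp.norm_apply_le x i
  have := abs_le.1 h
  constructor <;> linarith [this.1, this.2]

@[fun_prop]
lemma measurable_torusDist_zero {d : ℕ} {n : ℕ+} :
    Measurable fun ξ : Torus d n => torusDist ξ 0 := by
  unfold torusDist
  fun_prop

lemma torusDist_comm {d : ℕ} {n : ℕ+} (ξ η : Torus d n) : torusDist ξ η = torusDist η ξ := by
  simp only [torusDist, norm_sub_rev]

/-- In the cube every coordinate has modulus at most `n / 2`, hence is a shortest representative of
its class. -/
lemma torusDist_mk_zero {d : ℕ} {n : ℕ+} {x : EuclideanSpace ℝ (Fin d)}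
    (hx : x ∈ centredCube d n) :
    torusDist (fun i => ((x i : ℝ) : AddCircle ((n : ℕ) : ℝ))) 0 = ‖x‖ := by
  rw [torusDist, EuclideanSpace.norm_eq]
  congr 1
  refine Finset.sum_congr rfl fun i _ => ?_
  have hn : (0 : ℝ) < (n : ℕ) := Nat.cast_pos.2 n.pos
  have := hx i
  rw [Pi.zero_apply, sub_zero, (AddCircle.norm_coe_eq_abs_iff _ hn.ne').2, Real.norm_eq_abs]
  rw [abs_of_pos hn, abs_le]
  constructor <;> linarith [this.1, this.2]

lemma lintegral_torus_radial {d : ℕ} {n : ℕ+} {G : ℝ → ℝ≥0∞} (hG : Measurable G) :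
    ∫⁻ ξ : Torus d n, G (torusDist ξ 0) = ∫⁻ x in centredCube d n, G ‖x‖ := by
  let I : Set ℝ := Set.Ioc (-(((n : ℕ) : ℝ) / 2)) (-(((n : ℕ) : ℝ) / 2) + (n : ℕ))
  have h1 : MeasurePreserving
      (fun (a : Fin d → ℝ) (i : Fin d) => ((a i : ℝ) : AddCircle ((n : ℕ) : ℝ)))
      (Measure.pi fun _ => (volume : Measure ℝ).restrict I)
      (Measure.pi fun _ => (volume : Measure (AddCircle ((n : ℕ) : ℝ)))) :=
    measurePreserving_pi _ _ fun _ => AddCircle.measurePreserving_mk ((n : ℕ) : ℝ) _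
  refine (h1.lintegral_comp (f := fun ξ : Torus d n => G (torusDist ξ 0))
    (hG.comp measurable_torusDist_zero)).symm.trans ?_
  rw [← Measure.restrict_pi_pi, ← volume_pi]
  refine Eq.trans ?_ ((PiLp.volume_preserving_toLp (Fin d)).setLIntegral_comp_preimage
    (measurableSet_centredCube d n) (f := fun x => G ‖x‖) (hG.comp measurable_norm))
  have hset : (WithLp.toLp 2) ⁻¹' centredCube d n = Set.univ.pi fun _ : Fin d => I := by
    ext a
    simp [centredCube, I]
  rw [hset]
  refine setLIntegral_congr_fun (MeasurableSet.univ_pi fun _ => measurableSet_Ioc) fun a ha => ?_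
  have ha' : WithLp.toLp 2 a ∈ centredCube d n := by rw [← Set.mem_preimage, hset]; exact ha
  exact congrArg G (torusDist_mk_zero ha')

lemma tendsto_lintegral_centredCube {d : ℕ} {f : EuclideanSpace ℝ (Fin d) → ℝ≥0∞}
    (hf : Measurable f) :
    Tendsto (fun n : ℕ => ∫⁻ x in centredCube d n, f x) atTop (𝓝 (∫⁻ x, f x)) := by
  simp_rw [← lintegral_indicator (measurableSet_centredCube d _)]
  refine lintegral_tendsto_of_tendsto_of_monotone
    (fun n => (hf.indicator (measurableSet_centredCube d n)).aemeasurable)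
    (Eventually.of_forall fun x m n hmn => ?_) (Eventually.of_forall fun x => ?_)
  · exact Set.indicator_le_indicator_of_subset (centredCube_mono d hmn) (fun _ => zero_le) x
  · obtain ⟨N, hN⟩ := Set.mem_iUnion.1 ((iUnion_centredCube d).symm ▸ Set.mem_univ x)
    refine tendsto_const_nhds.congr' ?_
    filter_upwards [eventually_ge_atTop N] with n hn
    rw [Set.indicator_of_mem (centredCube_mono d hn hN)]

/-! ### The Laplace transforms of the in-edge sums -/

/-- The contribution of a point at distance `ρ` with mark `t`. -/
noncomputable def edgeTerm (α ρ : ℝ) (t : ℝ≥0) : ℝ≥0∞ :=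
  if ρ ≤ t then ENNReal.ofReal (ρ ^ α) else 0

lemma measurable_edgeTerm (α : ℝ) : Measurable fun p : ℝ × ℝ≥0 => edgeTerm α p.1 p.2 := by
  refine Measurable.ite (measurableSet_le measurable_fst (by fun_prop)) ?_ measurable_const
  exact ENNReal.measurable_ofReal.comp (measurable_fst.pow_const α)

lemma torusInEdgeSum_eq {d : ℕ} {n : ℕ+} (α : ℝ) (φ : Set (Torus d n × ℝ≥0)) :
    torusInEdgeSum α φ = ∑' x : φ, edgeTerm α (torusDist x.1.1 0) x.1.2 := by
  classical
  refine tsum_congr fun x => ?_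
  rw [Set.indicator_apply, edgeTerm, torusDist_comm]
  rfl

lemma inEdgeSum_eq {d : ℕ} (α : ℝ) (φ : Set (EuclideanSpace ℝ (Fin d) × ℝ≥0)) :
    inEdgeSum α φ = ∑' x : φ, edgeTerm α ‖x.1.1‖ x.1.2 := by
  classical
  refine tsum_congr fun x => ?_
  simp only [Set.indicator_apply, edgeTerm, mem_closedBall_zero_iff]

/-- The Laplace exponent density at distance `ρ`. -/
noncomputable def edgeExponent (Q : Measure ℝ≥0) (α : ℝ) (k : ℕ) (ρ : ℝ) : ℝ≥0∞ :=
  ∫⁻ t, (1 - expNeg (k * edgeTerm α ρ t)) ∂Q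

lemma measurable_edgeExponent (Q : Measure ℝ≥0) [SFinite Q] (α : ℝ) (k : ℕ) :
    Measurable (edgeExponent Q α k) := by
  refine Measurable.lintegral_prod_right'
    (f := fun p : ℝ × ℝ≥0 => 1 - expNeg (k * edgeTerm α p.1 p.2)) ?_
  have := measurable_edgeTerm α
  fun_prop

section

variable {Ω : Type*} [MeasurableSpace Ω] {P : Measure Ω} {Q : Measure ℝ≥0} {d : ℕ}

lemma aemeasurable_torusInEdgeSum {n : ℕ+} {X : Ω → Set (Torus d n × ℝ≥0)}
    (hX : IsMarkedPoissonProcess P Q X) (α : ℝ) :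
    AEMeasurable (fun ω => torusInEdgeSum α (X ω)) P := by
  simp_rw [torusInEdgeSum_eq]
  exact hX.aemeasurable_tsum (F := fun p => edgeTerm α (torusDist p.1 0) p.2)
    ((measurable_edgeTerm α).comp
      ((measurable_torusDist_zero.comp measurable_fst).prodMk measurable_snd))

lemma aemeasurable_inEdgeSum {X : Ω → Set (EuclideanSpace ℝ (Fin d) × ℝ≥0)}
    (hX : IsMarkedPoissonProcess P Q X) (α : ℝ) :
    AEMeasurable (fun ω => inEdgeSum α (X ω)) P := by
  simp_rw [inEdgeSum_eq]
  exact hX.aemeasurable_tsum (F := fun p => edgeTerm α ‖p.1‖ p.2)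
    ((measurable_edgeTerm α).comp (measurable_fst.norm.prodMk measurable_snd))

lemma laplace_torusInEdgeSum {n : ℕ+} [IsProbabilityMeasure P]
    [IsProbabilityMeasure Q] {X : Ω → Set (Torus d n × ℝ≥0)}
    (hX : IsMarkedPoissonProcess P Q X) (α : ℝ) (k : ℕ) :
    ∫⁻ ω, expNeg (k * torusInEdgeSum α (X ω)) ∂P =
      expNeg (∫⁻ x in centredCube d n, edgeExponent Q α k ‖x‖) := by
  simp_rw [torusInEdgeSum_eq, ← ENNReal.tsum_mul_left]
  rw [← lintegral_torus_radial (measurable_edgeExponent Q α k)]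
  refine hX.laplace (F := fun p => k * edgeTerm α (torusDist p.1 0) p.2) ?_
  exact Measurable.const_mul ((measurable_edgeTerm α).comp
      ((measurable_torusDist_zero.comp measurable_fst).prodMk measurable_snd)) _

lemma laplace_inEdgeSum [IsProbabilityMeasure P]
    [IsProbabilityMeasure Q] {X : Ω → Set (EuclideanSpace ℝ (Fin d) × ℝ≥0)}
    (hX : IsMarkedPoissonProcess P Q X) (α : ℝ) (k : ℕ) :
    ∫⁻ ω, expNeg (k * inEdgeSum α (X ω)) ∂P =
      expNeg (∫⁻ x : EuclideanSpace ℝ (Fin d), edgeExponent Q α k ‖x‖) := by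
  simp_rw [inEdgeSum_eq, ← ENNReal.tsum_mul_left]
  refine hX.laplace (F := fun p => k * edgeTerm α ‖p.1‖ p.2) ?_
  exact Measurable.const_mul ((measurable_edgeTerm α).comp
    (measurable_fst.norm.prodMk measurable_snd)) _

end

theorem tendstoInDistribution_torusInEdgeSum {d : ℕ} {Q : Measure ℝ≥0} [IsProbabilityMeasure Q]
    {Ω : ℕ+ → Type*} [∀ n, MeasurableSpace (Ω n)] {P : ∀ n, Measure (Ω n)}
    [∀ n, IsProbabilityMeasure (P n)] {X : ∀ n, Ω n → Set (Torus d n × ℝ≥0)}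
    (hX : ∀ n, IsMarkedPoissonProcess (P n) Q (X n))
    {Ω' : Type*} [MeasurableSpace Ω'] {P' : Measure Ω'} [IsProbabilityMeasure P']
    {X' : Ω' → Set (EuclideanSpace ℝ (Fin d) × ℝ≥0)}
    (hX' : IsMarkedPoissonProcess P' Q X') (α : ℝ) :
    TendstoInDistribution (fun n ω => torusInEdgeSum α (X n ω)) atTop
      (fun ω => inEdgeSum α (X' ω)) P P' := by
  refine tendstoInDistribution_of_tendsto_expNeg
    (fun n => aemeasurable_torusInEdgeSum (hX n) α) (aemeasurable_inEdgeSum hX' α) fun k => ?_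
  rw [laplace_inEdgeSum hX']
  simp_rw [fun n => laplace_torusInEdgeSum (hX n) α k]
  refine (continuous_expNeg.tendsto _).comp ?_
  exact (tendsto_lintegral_centredCube
    ((measurable_edgeExponent Q α k).comp measurable_norm)).comp tendsto_PNat_val_atTop_atTop

/-! ### Radial power functions outside a ball -/

section

variable {d : ℕ} {s u : ℝ}

lemma unitBallVolume_eq_ball (d : ℕ) : unitBallVolume d =
    (volume : Measure (EuclideanSpace ℝ (Fin d))).real (Metric.ball 0 1) := by
  rw [unitBallVolume, measureReal_def, measureReal_def,
    Measure.addHaar_unitClosedBall_eq_addHaar_unitBall]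

lemma unitBallVolume_pos (d : ℕ) : 0 < unitBallVolume d := by
  rw [unitBallVolume_eq_ball]
  exact ENNReal.toReal_pos (Metric.measure_ball_pos _ _ one_pos).ne' measure_ball_lt_top.ne

lemma measurableSet_lt_norm (d : ℕ) (u : ℝ) :
    MeasurableSet {x : EuclideanSpace ℝ (Fin d) | u < ‖x‖} :=
  measurableSet_lt measurable_const measurable_norm

lemma pow_mul_indicator_rpow (hd : 0 < d) (hu : 0 < u) {y : ℝ} :
    y ^ (d - 1) • (Set.Ioi u).indicator (fun z : ℝ => z ^ (-s)) y =
      (Set.Ioi u).indicator (fun z : ℝ => z ^ ((d : ℝ) - 1 - s)) y := by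
  by_cases hy : y ∈ Set.Ioi u
  · have hy0 : 0 < y := hu.trans hy
    rw [Set.indicator_of_mem hy, Set.indicator_of_mem hy, smul_eq_mul, ← Real.rpow_natCast,
      ← Real.rpow_add hy0, Nat.cast_sub hd, Nat.cast_one, sub_eq_add_neg ((d : ℝ) - 1)]
  · simp [Set.indicator_of_notMem hy]

lemma indicator_norm_rpow (x : EuclideanSpace ℝ (Fin d)) :
    {x : EuclideanSpace ℝ (Fin d) | u < ‖x‖}.indicator (fun x => ‖x‖ ^ (-s)) x =
      (Set.Ioi u).indicator (fun z : ℝ => z ^ (-s)) ‖x‖ := rfl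

/-- Polar coordinates reduce this to `∫ y^(d - 1 - s) dy` over `(u, ∞)`. -/
lemma integrableOn_norm_rpow_iff (hd : 0 < d) (hu : 0 < u) :
    IntegrableOn (fun x : EuclideanSpace ℝ (Fin d) => ‖x‖ ^ (-s)) {x | u < ‖x‖} ↔ (d : ℝ) < s := by
  have : Nonempty (Fin d) := ⟨⟨0, hd⟩⟩
  rw [← integrable_indicator_iff (measurableSet_lt_norm d u)]
  change Integrable (fun x : EuclideanSpace ℝ (Fin d) =>
    (Set.Ioi u).indicator (fun z : ℝ => z ^ (-s)) ‖x‖) volume ↔ _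
  rw [integrable_fun_norm_addHaar, finrank_euclideanSpace_fin]
  simp_rw [pow_mul_indicator_rpow hd hu]
  rw [IntegrableOn, integrable_indicator_iff measurableSet_Ioi, IntegrableOn,
    Measure.restrict_restrict measurableSet_Ioi, Set.inter_eq_left.2 (Set.Ioi_subset_Ioi hu.le),
    ← IntegrableOn, integrableOn_Ioi_rpow_iff hu]
  constructor <;> intro h <;> linarith

lemma setIntegral_norm_rpow (hd : 0 < d) (hu : 0 < u) (hs : (d : ℝ) < s) :
    ∫ x in {x : EuclideanSpace ℝ (Fin d) | u < ‖x‖}, ‖x‖ ^ (-s) =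
      d * unitBallVolume d / (s - d) * u ^ ((d : ℝ) - s) := by
  have : Nonempty (Fin d) := ⟨⟨0, hd⟩⟩
  rw [← integral_indicator (measurableSet_lt_norm d u)]
  simp_rw [indicator_norm_rpow]
  rw [integral_fun_norm_addHaar, finrank_euclideanSpace_fin, ← unitBallVolume_eq_ball]
  simp_rw [pow_mul_indicator_rpow hd hu]
  rw [integral_indicator measurableSet_Ioi, Measure.restrict_restrict measurableSet_Ioi,
    Set.inter_eq_left.2 (Set.Ioi_subset_Ioi hu.le), integral_Ioi_rpow_of_lt (by linarith) hu,
    nsmul_eq_mul, smul_eq_mul, show (d : ℝ) - 1 - s + 1 = -(s - d) by ring,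
    show (d : ℝ) - s = -(s - d) by ring]
  have : s - d ≠ 0 := by linarith
  field_simp

lemma lintegral_norm_rpow_eq_top (hd : 0 < d) (hu : 0 < u) (hs : s ≤ d) :
    ∫⁻ x in {x : EuclideanSpace ℝ (Fin d) | u < ‖x‖}, ENNReal.ofReal (‖x‖ ^ (-s)) = ∞ := by
  by_contra h
  refine hs.not_gt ((integrableOn_norm_rpow_iff hd hu).1 ?_)
  refine (lintegral_ofReal_ne_top_iff_integrable ?_ ?_).1 h
  · exact (measurable_norm.pow_const (-s)).aestronglyMeasurable
  · exact Eventually.of_forall fun x => by positivity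

end

/-! ### The survival function of the marks -/

/-- The probability that a mark is at least `y`. -/
noncomputable def markTail (Q : Measure ℝ≥0) (y : ℝ) : ℝ≥0∞ := Q {t : ℝ≥0 | y ≤ t}

lemma measurable_markTail (Q : Measure ℝ≥0) : Measurable (markTail Q) :=
  Antitone.measurable fun _ _ h => measure_mono fun _ ht => h.trans ht

section

variable {Q : Measure ℝ≥0} {d : ℕ} {s β : ℝ}

/-- The error is kept proportional to `y^(-s)` so that the bound can be integrated over the outside
of a ball. -/
lemma eventually_abs_markTail_sub_le
    (htail : Tendsto (fun y : ℝ => y ^ s * (markTail Q y).toReal) atTop (𝓝 β)) {ε : ℝ}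
    (hε : 0 < ε) :
    ∀ᶠ u : ℝ in atTop, 0 < u ∧ ∀ y, u < y →
      |(markTail Q y).toReal - β * y ^ (-s)| ≤ ε * y ^ (-s) := by
  have h := Metric.tendsto_atTop.1 htail ε hε
  obtain ⟨u₀, hu₀⟩ := h
  filter_upwards [eventually_ge_atTop u₀, eventually_gt_atTop 0] with u hu hu0
  refine ⟨hu0, fun y hy => ?_⟩
  have hy0 : 0 < y := hu0.trans hy
  have h1 := hu₀ y (hu.trans hy.le)
  rw [Real.dist_eq] at h1
  have h2 : (markTail Q y).toReal - β * y ^ (-s) =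
      (y ^ s * (markTail Q y).toReal - β) * y ^ (-s) := by
    rw [Real.rpow_neg hy0.le]
    have : y ^ s ≠ 0 := (Real.rpow_pos_of_pos hy0 s).ne'
    field_simp
  rw [h2, abs_mul, abs_of_pos (Real.rpow_pos_of_pos hy0 (-s))]
  exact mul_le_mul_of_nonneg_right h1.le (Real.rpow_nonneg hy0.le _)

/-- The intensity of the in-edges of length larger than `u`. -/
noncomputable def edgeIntensity (Q : Measure ℝ≥0) (d : ℕ) (u : ℝ) : ℝ≥0∞ :=
  ∫⁻ x in {x : EuclideanSpace ℝ (Fin d) | u < ‖x‖}, markTail Q ‖x‖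

/-- The intensity of the in-edges. -/
noncomputable def totalEdgeIntensity (Q : Measure ℝ≥0) (d : ℕ) : ℝ≥0∞ :=
  ∫⁻ x : EuclideanSpace ℝ (Fin d), markTail Q ‖x‖

lemma edgeIntensity_ne_top (h : totalEdgeIntensity Q d ≠ ∞) (u : ℝ) :
    edgeIntensity Q d u ≠ ∞ := ((setLIntegral_le_lintegral _ _).trans_lt h.lt_top).ne

lemma markTail_ne_top [IsProbabilityMeasure Q] (y : ℝ) : markTail Q y ≠ ∞ := measure_ne_top _ _

lemma markTail_le_one [IsProbabilityMeasure Q] (y : ℝ) : markTail Q y ≤ 1 := prob_le_one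

lemma eventually_integrableOn_markTail (hd : 0 < d) (hs : (d : ℝ) < s)
    (htail : Tendsto (fun y : ℝ => y ^ s * (markTail Q y).toReal) atTop (𝓝 β)) :
    ∀ᶠ u : ℝ in atTop, IntegrableOn
      (fun x : EuclideanSpace ℝ (Fin d) => (markTail Q ‖x‖).toReal) {x | u < ‖x‖} := by
  filter_upwards [eventually_abs_markTail_sub_le htail one_pos] with u hu
  refine Integrable.mono' (((integrableOn_norm_rpow_iff hd hu.1).2 hs).const_mul (1 + β)) ?_ ?_
  · exact ((measurable_markTail Q).comp measurable_norm).ennreal_toReal.aestronglyMeasurable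
  · filter_upwards [ae_restrict_mem (measurableSet_lt_norm d u)] with x hx
    have := (abs_le.1 (hu.2 ‖x‖ hx)).2
    rw [Real.norm_of_nonneg ENNReal.toReal_nonneg]
    linarith

/-- Outside a large ball the tail is of order `|x|^(-s)` with `s > d`; inside it is at most `1`. -/
lemma totalEdgeIntensity_ne_top [IsProbabilityMeasure Q] (hd : 0 < d) (hs : (d : ℝ) < s)
    (htail : Tendsto (fun y : ℝ => y ^ s * (markTail Q y).toReal) atTop (𝓝 β)) :
    totalEdgeIntensity Q d ≠ ∞ := by
  obtain ⟨u, hu⟩ := (eventually_integrableOn_markTail hd hs htail).exists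
  rw [totalEdgeIntensity, ← lintegral_add_compl _ (measurableSet_lt_norm d u)]
  refine ENNReal.add_ne_top.2 ⟨?_, ?_⟩
  · have := ((lintegral_ofReal_ne_top_iff_integrable hu.aestronglyMeasurable
      (Eventually.of_forall fun x => ENNReal.toReal_nonneg)).2 hu)
    simpa only [ENNReal.ofReal_toReal (markTail_ne_top _)] using this
  · refine ((lintegral_mono fun x => markTail_le_one _).trans_lt ?_).ne
    rw [setLIntegral_one]
    refine (measure_mono fun x hx => ?_).trans_lt
      (measure_closedBall_lt_top (x := (0 : EuclideanSpace ℝ (Fin d))) (r := u))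
    rw [mem_closedBall_zero_iff]
    exact not_lt.1 hx

lemma tendsto_edgeIntensity [IsProbabilityMeasure Q] (hd : 0 < d) (hs : (d : ℝ) < s)
    (htail : Tendsto (fun y : ℝ => y ^ s * (markTail Q y).toReal) atTop (𝓝 β)) :
    Tendsto (fun u : ℝ => u ^ (s - d) * (edgeIntensity Q d u).toReal) atTop
      (𝓝 (d * unitBallVolume d * β / (s - d))) := by
  set c : ℝ := d * unitBallVolume d / (s - d) with hc
  have hc0 : 0 < c := div_pos (mul_pos (Nat.cast_pos.2 hd) (unitBallVolume_pos d)) (by linarith)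
  rw [show d * unitBallVolume d * β / (s - d) = β * c by rw [hc]; ring, Metric.tendsto_nhds]
  intro ε hε
  -- The relative error `ε / (2c)` integrates to `(ε / 2) u^(d - s)`, since `|x|^(-s)` has integral
  -- `c u^(d - s)`.
  filter_upwards [eventually_abs_markTail_sub_le htail (ε := ε / (2 * c)) (by positivity),
    eventually_integrableOn_markTail hd hs htail] with u hu hint
  have hpow := (integrableOn_norm_rpow_iff hd hu.1).2 hs
  have hval := setIntegral_norm_rpow hd hu.1 hs
  have h1 : (edgeIntensity Q d u).toReal =
      ∫ x in {x : EuclideanSpace ℝ (Fin d) | u < ‖x‖}, (markTail Q ‖x‖).toReal :=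
    (integral_toReal ((measurable_markTail Q).comp measurable_norm).aemeasurable
      (Eventually.of_forall fun x => (markTail_ne_top _).lt_top)).symm
  have h2 : |∫ x in {x : EuclideanSpace ℝ (Fin d) | u < ‖x‖},
      ((markTail Q ‖x‖).toReal - β * ‖x‖ ^ (-s))| ≤
      ∫ x in {x : EuclideanSpace ℝ (Fin d) | u < ‖x‖}, ε / (2 * c) * ‖x‖ ^ (-s) := by
    rw [← Real.norm_eq_abs]
    refine norm_integral_le_of_norm_le (hpow.const_mul _) ?_
    filter_upwards [ae_restrict_mem (measurableSet_lt_norm d u)] with x hx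
    exact hu.2 ‖x‖ hx
  rw [integral_sub hint (hpow.const_mul β), integral_const_mul, integral_const_mul, hval, ← hc,
    ← h1] at h2
  have hu1 : u ^ (s - d) * u ^ ((d : ℝ) - s) = 1 := by
    rw [← Real.rpow_add hu.1]; simp
  have hu2 : 0 < u ^ (s - d) := Real.rpow_pos_of_pos hu.1 _
  have h3 : u ^ (s - d) * (edgeIntensity Q d u).toReal - β * c =
      u ^ (s - d) * ((edgeIntensity Q d u).toReal - β * (c * u ^ ((d : ℝ) - s))) := by
    linear_combination (β * c) * hu1
  rw [Real.dist_eq, h3, abs_mul, abs_of_pos hu2]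
  calc _ ≤ u ^ (s - d) * (ε / (2 * c) * (c * u ^ ((d : ℝ) - s))) :=
        mul_le_mul_of_nonneg_left h2 hu2.le
    _ = ε / 2 * (u ^ (s - d) * u ^ ((d : ℝ) - s)) := by field_simp
    _ < ε := by rw [hu1]; linarith

/-! ### Heavy tailed marks: infinite in-edge sums -/

lemma lintegral_edgeExponent_eq_top (hd : 0 < d) (hs : s ≤ d) (hβ : 0 < β)
    (htail : Tendsto (fun y : ℝ => y ^ s * (markTail Q y).toReal) atTop (𝓝 β)) {α : ℝ}
    (hα : 0 ≤ α) :
    ∫⁻ x : EuclideanSpace ℝ (Fin d), edgeExponent Q α 1 ‖x‖ = ∞ := by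
  -- For `|x| > u` the tail is at least `(β / 2) |x|^(-s)`, and `u ≥ 1` makes every term `|x|^α` of
  -- an edge at least `1`.
  obtain ⟨u, hu, hu1⟩ := ((eventually_abs_markTail_sub_le htail (half_pos hβ)).and
    (eventually_ge_atTop 1)).exists
  have hc : (1 - expNeg 1) * ENNReal.ofReal (β / 2) ≠ 0 := by
    refine mul_ne_zero (tsub_pos_iff_lt.2 ?_).ne' (ENNReal.ofReal_pos.2 (half_pos hβ)).ne'
    simpa using expNeg_strictAnti (zero_lt_one (α := ℝ≥0∞))
  have hc' : (1 - expNeg 1) * ENNReal.ofReal (β / 2) ≠ ∞ :=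
    ENNReal.mul_ne_top (tsub_le_self.trans_lt ENNReal.one_lt_top).ne ENNReal.ofReal_ne_top
  rw [eq_top_iff]
  calc (∞ : ℝ≥0∞) = (1 - expNeg 1) * ENNReal.ofReal (β / 2) *
        ∫⁻ x in {x : EuclideanSpace ℝ (Fin d) | u < ‖x‖}, ENNReal.ofReal (‖x‖ ^ (-s)) := by
        rw [lintegral_norm_rpow_eq_top hd hu.1 hs, ENNReal.mul_top hc]
    _ = ∫⁻ x in {x : EuclideanSpace ℝ (Fin d) | u < ‖x‖},
        (1 - expNeg 1) * ENNReal.ofReal (β / 2) * ENNReal.ofReal (‖x‖ ^ (-s)) :=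
        (lintegral_const_mul' _ _ hc').symm
    _ ≤ ∫⁻ x in {x : EuclideanSpace ℝ (Fin d) | u < ‖x‖}, edgeExponent Q α 1 ‖x‖ := by
        refine setLIntegral_mono' (measurableSet_lt_norm d u) fun x hx => ?_
        have hx' : u < ‖x‖ := hx
        have h1 : ENNReal.ofReal (β / 2) * ENNReal.ofReal (‖x‖ ^ (-s)) ≤ markTail Q ‖x‖ := by
          rw [← ENNReal.ofReal_mul (half_pos hβ).le]
          refine ENNReal.ofReal_le_of_le_toReal ?_
          have := (abs_le.1 (hu.2 ‖x‖ hx')).1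
          linarith
        rw [mul_assoc]
        refine (mul_le_mul_right h1 _).trans ?_
        have hm : MeasurableSet {t : ℝ≥0 | ‖x‖ ≤ t} :=
          measurableSet_le measurable_const (by fun_prop)
        rw [markTail, ← lintegral_indicator_const hm, edgeExponent]
        refine lintegral_mono fun t => ?_
        by_cases ht : ‖x‖ ≤ t
        · rw [Set.indicator_of_mem (show t ∈ {t : ℝ≥0 | ‖x‖ ≤ t} from ht), edgeTerm, if_pos ht,
            Nat.cast_one, one_mul]
          refine tsub_le_tsub_left (expNeg_strictAnti.antitone ?_) 1
          rw [ENNReal.one_le_ofReal]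
          exact Real.one_le_rpow (hu1.trans hx'.le) hα
        · rw [Set.indicator_of_notMem (show t ∉ {t : ℝ≥0 | ‖x‖ ≤ t} from ht)]
          exact zero_le
    _ ≤ _ := setLIntegral_le_lintegral _ _

theorem ae_inEdgeSum_eq_top [IsProbabilityMeasure Q]
    (hd : 0 < d) (hs : s ≤ d) (hβ : 0 < β)
    (htail : Tendsto (fun y : ℝ => y ^ s * (markTail Q y).toReal) atTop (𝓝 β))
    {Ω : Type*} [MeasurableSpace Ω] {P : Measure Ω} [IsProbabilityMeasure P]
    {X : Ω → Set (EuclideanSpace ℝ (Fin d) × ℝ≥0)} (hX : IsMarkedPoissonProcess P Q X) {α : ℝ}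
    (hα : 0 ≤ α) : ∀ᵐ ω ∂P, inEdgeSum α (X ω) = ∞ := by
  have h := laplace_inEdgeSum hX α 1
  rw [lintegral_edgeExponent_eq_top hd hs hβ htail hα, expNeg_top, Nat.cast_one] at h
  simp_rw [one_mul] at h
  rw [lintegral_eq_zero_iff' (f := fun ω => expNeg (inEdgeSum α (X ω)))
    (measurable_expNeg.comp_aemeasurable (aemeasurable_inEdgeSum hX α))]
    at h
  filter_upwards [h] with ω hω
  exact expNeg_eq_zero_iff.1 hω

end

/-! ### The in-degree -/

/-- The marked points that send an edge of length larger than `u` to the origin. -/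
def longEdges (d : ℕ) (u : ℝ) : Set (EuclideanSpace ℝ (Fin d) × ℝ≥0) :=
  {p | u < ‖p.1‖ ∧ ‖p.1‖ ≤ p.2}

/-- The marked points that send an edge to the origin. -/
def allEdges (d : ℕ) : Set (EuclideanSpace ℝ (Fin d) × ℝ≥0) := {p | ‖p.1‖ ≤ p.2}

lemma measurableSet_allEdges (d : ℕ) : MeasurableSet (allEdges d) :=
  measurableSet_le measurable_fst.norm (by fun_prop)

lemma measurableSet_longEdges (d : ℕ) (u : ℝ) : MeasurableSet (longEdges d u) :=
  (measurableSet_lt measurable_const measurable_fst.norm).inter (measurableSet_allEdges d)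

lemma lintegral_longEdges (Q : Measure ℝ≥0) (d : ℕ) (u : ℝ) :
    ∫⁻ x, Q {t | (x, t) ∈ longEdges d u} = edgeIntensity Q d u := by
  rw [edgeIntensity, ← lintegral_indicator (measurableSet_lt_norm d u)]
  refine lintegral_congr fun x => ?_
  by_cases hx : u < ‖x‖
  · rw [Set.indicator_of_mem (show x ∈ {x : EuclideanSpace ℝ (Fin d) | u < ‖x‖} from hx)]
    simp [longEdges, hx, markTail]
  · rw [Set.indicator_of_notMem
      (show x ∉ {x : EuclideanSpace ℝ (Fin d) | u < ‖x‖} from hx)]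
    simp [longEdges, hx]

/-- Fubini on `{|x| ≤ t}`: the section at `t` is a ball of volume `κ_d t^d`. -/
lemma totalEdgeIntensity_eq (Q : Measure ℝ≥0) [SFinite Q] (d : ℕ) :
    totalEdgeIntensity Q d =
      ENNReal.ofReal (unitBallVolume d) * ∫⁻ t : ℝ≥0, ENNReal.ofReal ((t : ℝ) ^ d) ∂Q := by
  have h1 := Measure.prod_apply (μ := (volume : Measure (EuclideanSpace ℝ (Fin d)))) (ν := Q)
    (measurableSet_allEdges d)
  rw [Measure.prod_apply_symm (measurableSet_allEdges d)] at h1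
  refine h1.symm.trans ?_
  rw [← lintegral_const_mul _ (by fun_prop)]
  refine lintegral_congr fun t => ?_
  have : (fun x : EuclideanSpace ℝ (Fin d) => (x, t)) ⁻¹' allEdges d =
      Metric.closedBall 0 (t : ℝ) := by
    ext x
    simp [allEdges]
  rw [this, Measure.addHaar_closedBall _ _ t.coe_nonneg, finrank_euclideanSpace_fin, mul_comm,
    unitBallVolume_eq_ball, ofReal_measureReal measure_ball_lt_top.ne]

section

variable {Ω : Type*} [MeasurableSpace Ω] {P : Measure Ω} [IsProbabilityMeasure P]
  {Q : Measure ℝ≥0} [IsProbabilityMeasure Q] {d : ℕ}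
  {X : Ω → Set (EuclideanSpace ℝ (Fin d) × ℝ≥0)}

lemma hasLaw_allEdges (hX : IsMarkedPoissonProcess P Q X) (h : totalEdgeIntensity Q d ≠ ∞) :
    HasLaw (fun ω => ∑' p : X ω, (allEdges d).indicator (fun _ => (1 : ℝ≥0∞)) p)
      ((poissonMeasure (totalEdgeIntensity Q d).toNNReal).map (Nat.cast : ℕ → ℝ≥0∞)) P :=
  hX.hasLaw_count (measurableSet_allEdges d) h

lemma hasLaw_longEdges (hX : IsMarkedPoissonProcess P Q X) (h : totalEdgeIntensity Q d ≠ ∞)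
    (u : ℝ) :
    HasLaw (fun ω => ∑' p : X ω, (longEdges d u).indicator (fun _ => (1 : ℝ≥0∞)) p)
      ((poissonMeasure (edgeIntensity Q d u).toNNReal).map (Nat.cast : ℕ → ℝ≥0∞)) P := by
  have := hX.hasLaw_count (measurableSet_longEdges d u)
    ((lintegral_longEdges Q d u).trans_ne (edgeIntensity_ne_top h u))
  rwa [lintegral_longEdges] at this

/-- The convention `0 ^ 0 = 1` makes a point at the origin count too. -/
lemma inEdgeSum_zero (φ : Set (EuclideanSpace ℝ (Fin d) × ℝ≥0)) :
    inEdgeSum 0 φ = ∑' p : φ, (allEdges d).indicator (fun _ => (1 : ℝ≥0∞)) p := by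
  classical
  rw [inEdgeSum_eq]
  refine tsum_congr fun p => ?_
  simp [edgeTerm, Set.indicator_apply, allEdges]

end

/-! ### Tail estimates for the Poisson distribution -/

lemma measure_map_natCast_lt (l : ℝ≥0) (n : ℕ) :
    (poissonMeasure l).map (Nat.cast : ℕ → ℝ≥0∞) {x | (n : ℝ≥0∞) < x} =
      poissonMeasure l {k | n < k} := by
  rw [Measure.map_apply measurable_from_top
    (measurableSet_lt measurable_const measurable_id')]
  congr 1
  ext k
  simp

lemma poissonMeasure_real_pos (l : ℝ≥0) :
    (poissonMeasure l).real {k | 0 < k} = 1 - Real.exp (-l) := by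
  have h : {k : ℕ | 0 < k} = {0}ᶜ := by ext k; simp [Nat.pos_iff_ne_zero]
  rw [h, probReal_compl_eq_one_sub (measurableSet_singleton 0), poissonMeasure_real_singleton]
  simp

lemma poissonMeasure_real_one_lt_le (l : ℝ≥0) :
    (poissonMeasure l).real {k | 1 < k} ≤ (l : ℝ) ^ 2 := by
  have h : {k : ℕ | 1 < k} = ({0, 1} : Set ℕ)ᶜ := by
    ext k
    simp only [Set.mem_ofPred_eq, Set.mem_compl_iff, Set.mem_insert_iff, Set.mem_singleton_iff]
    omega
  have h2 : (poissonMeasure l).real {0, 1} = Real.exp (-l) * (1 + l) := by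
    rw [Set.insert_eq, measureReal_union (by simp) (measurableSet_singleton 1),
      poissonMeasure_real_singleton, poissonMeasure_real_singleton]
    simp
    ring
  rw [h, probReal_compl_eq_one_sub ((measurableSet_singleton _).insert _), h2]
  -- Then `1 - exp(-l) (1 + l) ≤ 1 - (1 - l)(1 + l) = l²`.
  have h3 : 1 - (l : ℝ) ≤ Real.exp (-l) := by linarith [Real.add_one_le_exp (-(l : ℝ))]
  nlinarith [l.coe_nonneg]

/-- Chernoff bound at parameter `1`, from `E exp(N) = exp(l (e - 1))`. -/
lemma poissonMeasure_map_natCast_gt_le (l : ℝ≥0) {m : ℝ} (hm : 0 ≤ m) :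
    ((poissonMeasure l).map (Nat.cast : ℕ → ℝ≥0∞)).real {x | ENNReal.ofReal m < x} ≤
      Real.exp (-m) * Real.exp (l * (Real.exp 1 - 1)) := by
  have hexp : ∫⁻ n : ℕ, ENNReal.ofReal (Real.exp n) ∂(poissonMeasure l) =
      ENNReal.ofReal (Real.exp (l * (Real.exp 1 - 1))) := by
    rw [show (l : ℝ) * (Real.exp 1 - 1) = -(l * (1 - Real.exp 1)) by ring,
      ← tsum_ofReal_poisson l.coe_nonneg (Real.exp_pos 1).le, poissonMeasure,
      lintegral_sum_measure]
    refine tsum_congr fun n => ?_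
    rw [lintegral_smul_measure, lintegral_dirac, ← Real.exp_nat_mul, mul_one, smul_eq_mul]
  have hset : (Nat.cast : ℕ → ℝ≥0∞) ⁻¹' {x | ENNReal.ofReal m < x} = {n : ℕ | m < n} := by
    ext n
    rw [Set.mem_preimage, Set.mem_ofPred_eq, ← ENNReal.ofReal_natCast,
      ENNReal.ofReal_lt_ofReal_iff_of_nonneg hm, Set.mem_ofPred_eq]
  rw [measureReal_def, Measure.map_apply measurable_from_top
    (measurableSet_lt measurable_const measurable_id')]
  refine ENNReal.toReal_le_of_le_ofReal (by positivity) ?_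
  have hmark := mul_meas_ge_le_lintegral₀ (μ := poissonMeasure l)
    (f := fun n : ℕ => ENNReal.ofReal (Real.exp n)) measurable_from_top.aemeasurable
    (ENNReal.ofReal (Real.exp m))
  rw [hexp] at hmark
  have hpos : ENNReal.ofReal (Real.exp m) ≠ 0 := (ENNReal.ofReal_pos.2 (Real.exp_pos m)).ne'
  rw [Real.exp_neg, ENNReal.ofReal_mul (by positivity), ENNReal.ofReal_inv_of_pos (Real.exp_pos m),
    ← ENNReal.div_eq_inv_mul, ENNReal.le_div_iff_mul_le (Or.inl hpos) (Or.inl ENNReal.ofReal_ne_top),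
    mul_comm]
  refine (mul_le_mul_right (measure_mono fun n hn => ?_) _).trans hmark
  have hn' : n ∈ (Nat.cast : ℕ → ℝ≥0∞) ⁻¹' {x | ENNReal.ofReal m < x} := hn
  rw [hset] at hn'
  exact ENNReal.ofReal_le_ofReal (Real.exp_le_exp.2 (le_of_lt hn'))

/-! ### Tail of the in-edge sum -/

section

variable {d : ℕ} {α : ℝ} {φ : Set (EuclideanSpace ℝ (Fin d) × ℝ≥0)}

lemma ofReal_lt_inEdgeSum (hα : 0 < α) {t : ℝ} (ht : 0 ≤ t)
    (h : 0 < ∑' p : φ, (longEdges d (t ^ α⁻¹)).indicator (fun _ => (1 : ℝ≥0∞)) p) :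
    ENNReal.ofReal t < inEdgeSum α φ := by
  obtain ⟨p, hp⟩ : ∃ p : φ, (longEdges d (t ^ α⁻¹)).indicator (fun _ => (1 : ℝ≥0∞)) p ≠ 0 := by
    by_contra! hcon
    exact h.ne' (ENNReal.tsum_eq_zero.2 hcon)
  have hp' : (p : EuclideanSpace ℝ (Fin d) × ℝ≥0) ∈ longEdges d (t ^ α⁻¹) :=
    Set.mem_of_indicator_ne_zero hp
  rw [inEdgeSum_eq]
  refine lt_of_lt_of_le ?_
    (ENNReal.le_tsum (f := fun x : φ => edgeTerm α ‖x.1.1‖ x.1.2) p)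
  have h1 : t < ‖p.1.1‖ ^ α := (Real.rpow_inv_lt_iff_of_pos ht (norm_nonneg _) hα).1 hp'.1
  rw [edgeTerm, if_pos hp'.2]
  exact (ENNReal.ofReal_lt_ofReal_iff_of_nonneg ht).2 h1

lemma inEdgeSum_le (hα : 0 < α) {b v m : ℝ} (hb : 0 ≤ b) (hv : 0 ≤ v) (hm : 0 ≤ m)
    (h0 : ∑' p : φ, (longEdges d (b ^ α⁻¹)).indicator (fun _ => (1 : ℝ≥0∞)) p = 0)
    (h1 : ∑' p : φ, (longEdges d (v ^ α⁻¹)).indicator (fun _ => (1 : ℝ≥0∞)) p ≤ 1)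
    (h2 : ∑' p : φ, (allEdges d).indicator (fun _ => (1 : ℝ≥0∞)) p ≤ ENNReal.ofReal m) :
    inEdgeSum α φ ≤ ENNReal.ofReal (v * m + b) := by
  -- Each edge contributes at most `v`, except at most one exceptional edge, which contributes at
  -- most `b`.
  have hterm (p : φ) : edgeTerm α ‖p.1.1‖ p.1.2 ≤
      ENNReal.ofReal v * (allEdges d).indicator (fun _ => (1 : ℝ≥0∞)) p +
        ENNReal.ofReal b * (longEdges d (v ^ α⁻¹)).indicator (fun _ => (1 : ℝ≥0∞)) p := by
    by_cases hp : ‖p.1.1‖ ≤ p.1.2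
    · rw [edgeTerm, if_pos hp, Set.indicator_of_mem (show (p : _ × ℝ≥0) ∈ allEdges d from hp),
        mul_one]
      have hpb : ‖p.1.1‖ ^ α ≤ b := by
        by_contra! hlt
        have hmem : (p : EuclideanSpace ℝ (Fin d) × ℝ≥0) ∈ longEdges d (b ^ α⁻¹) :=
          ⟨(Real.rpow_inv_lt_iff_of_pos hb (norm_nonneg _) hα).2 hlt, hp⟩
        have := ENNReal.tsum_eq_zero.1 h0 p
        rw [Set.indicator_of_mem hmem] at this
        exact one_ne_zero this
      by_cases hpv : ‖p.1.1‖ ^ α ≤ v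
      · exact le_add_right (ENNReal.ofReal_le_ofReal hpv)
      · have hmem : (p : EuclideanSpace ℝ (Fin d) × ℝ≥0) ∈ longEdges d (v ^ α⁻¹) :=
          ⟨(Real.rpow_inv_lt_iff_of_pos hv (norm_nonneg _) hα).2 (not_le.1 hpv), hp⟩
        rw [Set.indicator_of_mem hmem, mul_one]
        exact le_add_left (ENNReal.ofReal_le_ofReal hpb)
    · rw [edgeTerm, if_neg hp]
      exact zero_le
  rw [inEdgeSum_eq]
  refine (ENNReal.tsum_le_tsum hterm).trans ?_
  rw [ENNReal.tsum_add, ENNReal.tsum_mul_left, ENNReal.tsum_mul_left,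
    ENNReal.ofReal_add (mul_nonneg hv hm) hb, ENNReal.ofReal_mul hv]
  refine add_le_add (mul_le_mul_right h2 _) ?_
  calc _ ≤ ENNReal.ofReal b * 1 := mul_le_mul_right h1 _
    _ = _ := mul_one _

end

section

variable {Ω : Type*} [MeasurableSpace Ω] {P : Measure Ω} [IsProbabilityMeasure P]
  {Q : Measure ℝ≥0} [IsProbabilityMeasure Q] {d : ℕ} {α s β : ℝ}
  {X : Ω → Set (EuclideanSpace ℝ (Fin d) × ℝ≥0)}

lemma measureReal_longEdges (hX : IsMarkedPoissonProcess P Q X)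
    (h : totalEdgeIntensity Q d ≠ ∞) (u : ℝ) (n : ℕ) :
    P.real {ω | (n : ℝ≥0∞) <
        ∑' p : X ω, (longEdges d u).indicator (fun _ => (1 : ℝ≥0∞)) p} =
      (poissonMeasure (edgeIntensity Q d u).toNNReal).real {k | n < k} := by
  rw [measureReal_def, (hasLaw_longEdges hX h u).measure_eq (p := fun x => (n : ℝ≥0∞) < x)
    (measurableSet_lt measurable_const measurable_id), measure_map_natCast_lt, measureReal_def]

lemma le_measureReal_inEdgeSum (hX : IsMarkedPoissonProcess P Q X)
    (h : totalEdgeIntensity Q d ≠ ∞) (hα : 0 < α) {t : ℝ} (ht : 0 ≤ t) :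
    1 - Real.exp (-(edgeIntensity Q d (t ^ α⁻¹)).toReal) ≤
      P.real {ω | ENNReal.ofReal t < inEdgeSum α (X ω)} := by
  have h1 := measureReal_longEdges hX h (t ^ α⁻¹) 0
  rw [poissonMeasure_real_pos] at h1
  refine (ge_of_eq h1).trans ?_
  refine measureReal_mono fun ω hω => ?_
  refine ofReal_lt_inEdgeSum hα ht ?_
  simpa using hω

lemma measureReal_inEdgeSum_le (hX : IsMarkedPoissonProcess P Q X)
    (h : totalEdgeIntensity Q d ≠ ∞) (hα : 0 < α) {t b v m : ℝ} (hb : 0 ≤ b) (hv : 0 ≤ v)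
    (hm : 0 ≤ m) (ht : v * m + b ≤ t) :
    P.real {ω | ENNReal.ofReal t < inEdgeSum α (X ω)} ≤
      (edgeIntensity Q d (b ^ α⁻¹)).toReal + (edgeIntensity Q d (v ^ α⁻¹)).toReal ^ 2 +
        Real.exp (-m) * Real.exp ((totalEdgeIntensity Q d).toReal * (Real.exp 1 - 1)) := by
  have hsub : {ω | ENNReal.ofReal t < inEdgeSum α (X ω)} ⊆
      ({ω | ((0 : ℕ) : ℝ≥0∞) <
          ∑' p : X ω, (longEdges d (b ^ α⁻¹)).indicator (fun _ => (1 : ℝ≥0∞)) p} ∪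
        {ω | ((1 : ℕ) : ℝ≥0∞) <
          ∑' p : X ω, (longEdges d (v ^ α⁻¹)).indicator (fun _ => (1 : ℝ≥0∞)) p}) ∪
        {ω | ENNReal.ofReal m <
          ∑' p : X ω, (allEdges d).indicator (fun _ => (1 : ℝ≥0∞)) p} := by
    intro ω hω
    by_contra hcon
    simp only [Set.mem_union, Set.mem_ofPred_eq, not_or, not_lt, Nat.cast_zero, Nat.cast_one,
      nonpos_iff_eq_zero] at hcon
    have hω' : ENNReal.ofReal t < inEdgeSum α (X ω) := hω
    exact absurd (inEdgeSum_le hα hb hv hm hcon.1.1 hcon.1.2 hcon.2)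
      (not_le.2 ((ENNReal.ofReal_le_ofReal ht).trans_lt hω'))
  refine (measureReal_mono hsub).trans ((measureReal_union_le _ _).trans (add_le_add
    ((measureReal_union_le _ _).trans (add_le_add ?_ ?_)) ?_))
  · rw [measureReal_longEdges hX h, poissonMeasure_real_pos]
    have := Real.add_one_le_exp (-((edgeIntensity Q d (b ^ α⁻¹)).toNNReal : ℝ))
    rw [ENNReal.coe_toNNReal_eq_toReal] at *
    linarith
  · rw [measureReal_longEdges hX h]
    exact poissonMeasure_real_one_lt_le _
  · rw [measureReal_def, (hasLaw_allEdges hX h).measure_eq (p := fun x => ENNReal.ofReal m < x)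
      (measurableSet_lt measurable_const measurable_id), ← measureReal_def]
    exact poissonMeasure_map_natCast_gt_le _ hm

/-- From `exp(-x) ≤ 1 / (1 + x)` and `(x - x²)(1 + x) = x - x³ ≤ x`. -/
lemma sub_sq_le_one_sub_exp_neg {x : ℝ} (hx : 0 ≤ x) : x - x ^ 2 ≤ 1 - Real.exp (-x) := by
  have h1 : Real.exp (-x) * (1 + x) ≤ 1 := by
    calc Real.exp (-x) * (1 + x) ≤ Real.exp (-x) * Real.exp x :=
          mul_le_mul_of_nonneg_left (by linarith [Real.add_one_le_exp x]) (Real.exp_pos _).le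
      _ = 1 := by rw [← Real.exp_add]; simp
  have h2 : 0 ≤ x ^ 3 := by positivity
  nlinarith [Real.exp_pos (-x)]

theorem tendsto_measureReal_inEdgeSum (hX : IsMarkedPoissonProcess P Q X) (hd : 0 < d)
    (hs : (d : ℝ) < s)
    (htail : Tendsto (fun y : ℝ => y ^ s * (markTail Q y).toReal) atTop (𝓝 β)) (hα : 0 < α) :
    Tendsto (fun t : ℝ => t ^ ((s - d) / α) *
      P.real {ω | ENNReal.ofReal t < inEdgeSum α (X ω)}) atTop
      (𝓝 (d * unitBallVolume d * β / (s - d))) := by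
  have htot : totalEdgeIntensity Q d ≠ ∞ := totalEdgeIntensity_ne_top hd hs htail
  set c : ℝ := d * unitBallVolume d * β / (s - d)
  set γ : ℝ := (s - d) / α with hγ
  have hγ0 : 0 < γ := div_pos (sub_pos.2 hs) hα
  let lam (w : ℝ) : ℝ := (edgeIntensity Q d (w ^ α⁻¹)).toReal
  have hg : Tendsto (fun w : ℝ => w ^ γ * lam w) atTop (𝓝 c) := by
    refine ((tendsto_edgeIntensity hd hs htail).comp
      (tendsto_rpow_atTop (inv_pos.2 hα))).congr' ?_
    filter_upwards [eventually_ge_atTop 0] with w hw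
    simp only [Function.comp_apply, lam]
    rw [← Real.rpow_mul hw, hγ, inv_mul_eq_div]
  have hlow : Tendsto (fun t : ℝ => t ^ γ * lam t - (t ^ γ * lam t) ^ 2 * t ^ (-γ)) atTop
      (𝓝 c) := by
    simpa using hg.sub ((hg.pow 2).mul (tendsto_rpow_neg_atTop hγ0))
  -- `7/8 = 3/4 + 1/8` is the exponent of `v m`. It is below `1`, so `b ~ t`.
  let b (t : ℝ) : ℝ := t - t ^ (7 / 8 : ℝ)
  have hbt : Tendsto (fun t => b t / t) atTop (𝓝 1) := by
    have h1 : Tendsto (fun t : ℝ => 1 - t ^ (-(1 / 8 : ℝ))) atTop (𝓝 (1 - 0)) :=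
      tendsto_const_nhds.sub (tendsto_rpow_neg_atTop (by norm_num))
    rw [sub_zero] at h1
    refine h1.congr' ?_
    filter_upwards [eventually_gt_atTop 0] with t ht
    have h2 : t ^ (7 / 8 : ℝ) = t ^ (-(1 / 8 : ℝ)) * t := by
      nth_rewrite 3 [← Real.rpow_one t]
      rw [← Real.rpow_add ht]
      norm_num
    simp only [b]
    rw [h2]
    field_simp
  have hb : Tendsto b atTop atTop := by
    refine (hbt.pos_mul_atTop one_pos tendsto_id).congr' ?_
    filter_upwards [eventually_gt_atTop 0] with t ht
    simp [ht.ne']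
  have hterm1 : Tendsto (fun t => (b t / t) ^ (-γ) * (b t ^ γ * lam (b t))) atTop (𝓝 c) := by
    have := (hbt.rpow_const (p := -γ) (Or.inl one_ne_zero)).mul (hg.comp hb)
    simpa using this
  have hv : Tendsto (fun t : ℝ => t ^ (3 / 4 : ℝ)) atTop atTop := tendsto_rpow_atTop (by norm_num)
  -- `Λ(v^(1/α))²` is `O(t^(-3γ/2))`, which beats `t^γ` because `3/4 > 1/2`.
  have hterm2 : Tendsto (fun t : ℝ => ((t ^ (3 / 4 : ℝ)) ^ γ * lam (t ^ (3 / 4 : ℝ))) ^ 2 *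
      t ^ (-(γ / 2))) atTop (𝓝 0) := by
    have := ((hg.comp hv).pow 2).mul (tendsto_rpow_neg_atTop (half_pos hγ0))
    simpa using this
  set K : ℝ := Real.exp ((totalEdgeIntensity Q d).toReal * (Real.exp 1 - 1))
  have hterm3 : Tendsto (fun t : ℝ => (t ^ (1 / 8 : ℝ)) ^ (8 * γ) *
      Real.exp (-1 * t ^ (1 / 8 : ℝ)) * K) atTop (𝓝 0) := by
    have := ((tendsto_rpow_mul_exp_neg_mul_atTop_nhds_zero (8 * γ) 1 one_pos).comp
      (tendsto_rpow_atTop (y := (1 / 8 : ℝ)) (by norm_num))).mul_const K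
    simpa using this
  have hup := (hterm1.add hterm2).add hterm3
  rw [add_zero, add_zero] at hup
  refine tendsto_of_tendsto_of_tendsto_of_le_of_le' hlow hup ?_ ?_
  · filter_upwards [eventually_gt_atTop 0] with t ht
    have h1 := (sub_sq_le_one_sub_exp_neg ENNReal.toReal_nonneg).trans
      (le_measureReal_inEdgeSum hX htot hα ht.le)
    have h2 := mul_le_mul_of_nonneg_left h1 (Real.rpow_nonneg ht.le γ)
    refine le_trans (le_of_eq ?_) h2
    have h3 : t ^ γ * t ^ (-γ) = 1 := by rw [← Real.rpow_add ht]; simp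
    simp only [lam]
    linear_combination (-(t ^ γ * (edgeIntensity Q d (t ^ α⁻¹)).toReal ^ 2)) * h3
  · filter_upwards [eventually_gt_atTop 0, hb.eventually_gt_atTop 0] with t ht hbt0
    have hvm : t ^ (3 / 4 : ℝ) * t ^ (1 / 8 : ℝ) + b t ≤ t := by
      rw [← Real.rpow_add ht]
      simp only [b]
      norm_num
    have h1 := measureReal_inEdgeSum_le hX htot hα hbt0.le (Real.rpow_nonneg ht.le _)
      (Real.rpow_nonneg ht.le _) hvm
    have h2 := mul_le_mul_of_nonneg_left h1 (Real.rpow_nonneg ht.le γ)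
    refine h2.trans (le_of_eq ?_)
    have e1 : t ^ γ = (b t / t) ^ (-γ) * b t ^ γ := by
      rw [Real.rpow_neg (div_pos hbt0 ht).le, Real.div_rpow hbt0.le ht.le]
      have := (Real.rpow_pos_of_pos hbt0 γ).ne'
      have := (Real.rpow_pos_of_pos ht γ).ne'
      field_simp
    have e2 : t ^ γ = ((t ^ (3 / 4 : ℝ)) ^ γ) ^ 2 * t ^ (-(γ / 2)) := by
      rw [← Real.rpow_mul ht.le, ← Real.rpow_natCast, ← Real.rpow_mul ht.le, ← Real.rpow_add ht]
      congr 1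
      push_cast
      ring
    have e3 : t ^ γ = (t ^ (1 / 8 : ℝ)) ^ (8 * γ) := by
      rw [← Real.rpow_mul ht.le]
      congr 1
      ring
    rw [mul_add, mul_add, neg_one_mul, ← mul_assoc ((b t / t) ^ (-γ)), ← e1, ← e3]
    simp only [lam]
    linear_combination ((edgeIntensity Q d ((t ^ (3 / 4 : ℝ)) ^ α⁻¹)).toReal ^ 2) * e2

end

/-! ### The main theorem -/

/-- The edge condition `|ξ| ≤ r` yields `P(R ≥ y)`, while the hypothesis speaks of `P(R > y)`.
Absolute continuity excludes an atom at `y`. -/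
lemma toReal_markTail_map {Ω₀ : Type*} [MeasurableSpace Ω₀] {P₀ : Measure Ω₀} {R : Ω₀ → ℝ≥0}
    (hR : Measurable R) (hRac : P₀.map (fun ω => (R ω : ℝ)) ≪ volume) (y : ℝ) :
    (markTail (P₀.map R) y).toReal = P₀.real {ω | y < (R ω : ℝ)} := by
  have hR' : Measurable fun ω => (R ω : ℝ) := hR.coe_nnreal_real
  rw [markTail, Measure.map_apply hR (measurableSet_le measurable_const (by fun_prop)),
    measureReal_def]
  congr 1
  refine measure_congr ?_
  have h0 : P₀ {ω | (R ω : ℝ) = y} = 0 := by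
    have := hRac (Real.volume_singleton (a := y))
    rwa [Measure.map_apply hR' (measurableSet_singleton y)] at this
  have hae : ∀ᵐ ω ∂P₀, (R ω : ℝ) ≠ y := by
    rw [ae_iff]
    simpa using h0
  filter_upwards [hae] with ω hω
  exact propext ⟨fun h => lt_of_le_of_ne h (Ne.symm hω), fun h => le_of_lt h⟩

theorem theorem2 {d : ℕ} (hd : 2 ≤ d)
    -- the typical mark `R`: absolutely continuous with a polynomial tail of index `s`
    {Ω₀ : Type*} [MeasurableSpace Ω₀] (P₀ : Measure Ω₀) [IsProbabilityMeasure P₀]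
    (R : Ω₀ → ℝ≥0) (hR : Measurable R)
    (hRac : P₀.map (fun ω => (R ω : ℝ)) ≪ volume)
    (β s : ℝ) (hβ : 0 < β) (hs : 0 < s)
    (htail : Tendsto (fun h : ℝ => h ^ s * P₀.real {ω | h < (R ω : ℝ)}) atTop (𝓝 β))
    -- the marked Poisson point processes on the tori of side lengths `n = 1, 2, …`
    {Ω : ℕ+ → Type*} [∀ n, MeasurableSpace (Ω n)] (P : ∀ n, Measure (Ω n))
    [∀ n, IsProbabilityMeasure (P n)] (X : ∀ n, Ω n → Set (Torus d n × ℝ≥0))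
    (hX : ∀ n, IsMarkedPoissonProcess (P n) (P₀.map R) (X n))
    -- the marked Poisson point process on `ℝᵈ`
    {Ω' : Type*} [MeasurableSpace Ω'] (P' : Measure Ω') [IsProbabilityMeasure P']
    (X' : Ω' → Set (EuclideanSpace ℝ (Fin d) × ℝ≥0))
    (hX' : IsMarkedPoissonProcess P' (P₀.map R) X') :
    (∀ α : ℝ, 0 ≤ α →
      TendstoInDistribution (fun n ω => torusInEdgeSum α (X n ω)) atTop
        (fun ω => inEdgeSum α (X' ω)) P P') ∧
    (s ≤ d → ∀ α : ℝ, 0 ≤ α → ∀ᵐ ω ∂P', inEdgeSum α (X' ω) = ∞) ∧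
    (d < s →
      Integrable (fun ω => (R ω : ℝ) ^ d) P₀ ∧
      HasLaw (fun ω => inEdgeSum 0 (X' ω))
        ((poissonMeasure (unitBallVolume d * ∫ ω, (R ω : ℝ) ^ d ∂P₀).toNNReal).map
          (Nat.cast : ℕ → ℝ≥0∞)) P') ∧
    (d < s → ∀ α : ℝ, 0 < α →
      Tendsto (fun t : ℝ => t ^ ((s - d) / α) *
          P'.real {ω | ENNReal.ofReal t < inEdgeSum α (X' ω)}) atTop
        (𝓝 (d * unitBallVolume d * β / (s - d)))) := by
  have hd0 : 0 < d := by omega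
  have hQ : IsProbabilityMeasure (P₀.map R) := Measure.isProbabilityMeasure_map hR.aemeasurable
  have htail' : Tendsto (fun y : ℝ => y ^ s * (markTail (P₀.map R) y).toReal) atTop (𝓝 β) := by
    simpa only [toReal_markTail_map hR hRac] using htail
  refine ⟨fun α _ => tendstoInDistribution_torusInEdgeSum hX hX' α,
    fun hsd α hα => ae_inEdgeSum_eq_top hd0 hsd hβ htail' hX' hα, fun hsd => ?_,
    fun hsd α hα => tendsto_measureReal_inEdgeSum hX' hd0 hsd htail' hα⟩
  have htot := totalEdgeIntensity_ne_top hd0 hsd htail'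
  have heq := totalEdgeIntensity_eq (P₀.map R) d
  rw [lintegral_map (by fun_prop) hR] at heq
  have hκ : ENNReal.ofReal (unitBallVolume d) ≠ 0 :=
    (ENNReal.ofReal_pos.2 (unitBallVolume_pos d)).ne'
  -- Finite total intensity and `κ_d > 0` force `E R^d < ∞`.
  have hfin : ∫⁻ ω, ENNReal.ofReal ((R ω : ℝ) ^ d) ∂P₀ ≠ ∞ := fun h => by
    rw [h, ENNReal.mul_top hκ] at heq
    exact htot heq
  have hnn : 0 ≤ᵐ[P₀] fun ω => (R ω : ℝ) ^ d := Eventually.of_forall fun ω => by positivity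
  have hint : Integrable (fun ω => (R ω : ℝ) ^ d) P₀ :=
    (lintegral_ofReal_ne_top_iff_integrable
      (hR.coe_nnreal_real.pow_const d).aestronglyMeasurable hnn).1 hfin
  refine ⟨hint, ?_⟩
  have hrate : (totalEdgeIntensity (P₀.map R) d).toNNReal =
      (unitBallVolume d * ∫ ω, (R ω : ℝ) ^ d ∂P₀).toNNReal := by
    rw [heq, ← ofReal_integral_eq_lintegral_ofReal hint hnn,
      ← ENNReal.ofReal_mul (unitBallVolume_pos d).le]
    rfl
  simp_rw [inEdgeSum_zero]
  rw [← hrate]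
  exact hasLaw_allEdges hX' htot
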